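/- Let $d\ge 1$ be an integer, $\beta\ge \frac d2-1$ and $\alpha>-\frac12$. For $s>0$ set $$ \psi(s)=\begin{cases}(1+s)^{\frac12(d-2\alpha-1)}&\text{if }\alpha<\frac{d-1}2,\\ 1+\ln(1+s)&\text{if }\alpha=\frac{d-1}2,\\ 1&\text{if }\alpha>\frac{d-1}2.\end{cases} $$ For $\varphi\in L^1(\mathbb R^d)$ (complex-valued) let $\widehat\varphi(\xi)=\int_{\mathbb R^d}\varphi(t)e^{-2i\pi\langle t,\xi\rangle}\,dt$, and let $|\varphi|^*$ be its symmetric decreasing rearrangement, $$ |\varphi|^*(x)=\int_0^{\infty}\chi_{\{y\,:\,|\varphi(y)|>\lambda\}^*}(x)\,d\lambda , $$ where, for a set $E$ of finite Lebesgue measure $|E|$, $E^*$ is the open ball centred at $0$ with $|E^*|=|E|$. Write $t_+^\gamma=t^\gamma$ for $t>0$ and $t_+^\gamma=0$ for $t\le 0$. Then there is a constant $C=C(d,\alpha,\beta)>0$ such that, for all $S,\Omega>0$, every $\varphi\in L^1(\mathbb R^d)$ whose support $\{\varphi\ne0\}$ has finite measure $S$, and all $a,x\in\mathbb R^d$, $$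 \Omega^{-d}\left|\int_{\mathbb R^d}\widehat\varphi(\xi)\Bigl(1-\frac{|\xi-a|^2}{\Omega^2}\Bigr)_+^{\alpha}e^{2i\pi\langle x,\xi\rangle}\,d\xi\right| \le C\,\psi(\Omega^dS)\,\Omega^{-d}\int_{\mathbb R^d}\Bigl(1-\frac{|\xi|^2}{\Omega^2}\Bigr)_+^{\beta}\,\widehat{|\varphi|^*}(\xi)\,d\xi . $$ Here $|\varphi|^*\in L^1(\mathbb R^d)$, both integrals converge absolutely, and the integral on the right is a real number. -/

import Mathlib

open MeasureTheory
open scoped FourierTransform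

noncomputable section

/-- `t_+^α`: equal to `t ^ α` for `t > 0` and to `0` for `t ≤ 0` (also when `α ≤ 0`). -/
def truncPow (α t : ℝ) : ℝ := if 0 < t then t ^ α else 0

/-- The Bochner–Riesz multiplier `ξ ↦ (1 - |ξ|² / Ω²)_+^α` on `ℝ^d`. -/
def bochnerRiesz {d : ℕ} (α Ω : ℝ) (ξ : EuclideanSpace ℝ (Fin d)) : ℝ :=
  truncPow α (1 - ‖ξ‖ ^ 2 / Ω ^ 2)

/-- The symmetric rearrangement `E^*` of a set `E` of finite measure: the open ball `B(0,r)` with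
`|B(0,1)| r^d = |E|`. -/
def symmRearrSet {d : ℕ} (E : Set (EuclideanSpace ℝ (Fin d))) :
    Set (EuclideanSpace ℝ (Fin d)) :=
  Metric.ball 0
    ((volume.real E / volume.real (Metric.ball (0 : EuclideanSpace ℝ (Fin d)) 1)) ^ (1 / (d : ℝ)))

/-- The symmetric decreasing rearrangement
`|φ|^*(x) = ∫_0^∞ χ_{{y : |φ(y)| > l}^*}(x) dl`.
The integral is taken in `[0,∞]`; for integrable `φ` it can be infinite only at `x = 0`. -/
def symmRearr {d : ℕ} (φ : EuclideanSpace ℝ (Fin d) → ℂ) (x : EuclideanSpace ℝ (Fin d)) : ℝ :=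
  (∫⁻ l in Set.Ioi (0 : ℝ), (symmRearrSet {y | l < ‖φ y‖}).indicator 1 x).toReal

/-- The growth function `ψ`. -/
def growth (d : ℕ) (α s : ℝ) : ℝ :=
  if α < ((d : ℝ) - 1) / 2 then (1 + s) ^ (((d : ℝ) - 2 * α - 1) / 2)
  else if α = ((d : ℝ) - 1) / 2 then 1 + Real.log (1 + s)
  else 1

/-- The integrand `φ̂(ξ) (1 - |ξ - a|² / Ω²)_+^α e^{2iπ⟨x,ξ⟩}` of the Bochner–Riesz mean. -/
def meanIntegrand {d : ℕ} (α Ω : ℝ) (a x : EuclideanSpace ℝ (Fin d))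
    (φ : EuclideanSpace ℝ (Fin d) → ℂ) (ξ : EuclideanSpace ℝ (Fin d)) : ℂ :=
  𝓕 φ ξ * (bochnerRiesz α Ω (ξ - a) : ℂ) *
    Complex.exp (2 * (Real.pi : ℂ) * Complex.I * ((inner ℝ x ξ : ℝ) : ℂ))

/-- The integrand `(1 - |ξ|² / Ω²)_+^β (|φ|^*)^(ξ)`. -/
def rearrIntegrand {d : ℕ} (β Ω : ℝ)
    (φ : EuclideanSpace ℝ (Fin d) → ℂ) (ξ : EuclideanSpace ℝ (Fin d)) : ℂ :=
  (bochnerRiesz β Ω ξ : ℂ) *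
    𝓕 (fun t : EuclideanSpace ℝ (Fin d) => ((symmRearr φ t : ℝ) : ℂ)) ξ

end

section

open Set ProbabilityTheory
open scoped ENNReal

/-! ### The Bessel–Clifford function -/

/-! Both sides are compared with one quantity, M = ∫_0^∞ min(1, (Ω r_l)^d) dl, where r_l is the
radius of {|φ| > l}^*. Fourier duality moves the transform onto the multiplier, and the transform of
(1 - |ξ|²/Ω²)_+^γ is A Ω^d B_{γ+d/2}(π²Ω²|t|²) with A > 0 and B_ν = `besselClifford ν`
(`exists_fourier_bochnerRiesz`).

Upper bound: an energy estimate for Bessel's equation gives |B_ν(r²/4)| ≤ C (1+r)^{-(ν+1/2)}, a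
radially decreasing majorant of the kernel; the parameters a and x only multiply the kernel by a
phase and translate it. By the layer cake formula it suffices to integrate the majorant over each
superlevel set, and replacing that set by a ball of equal volume costs a factor 2
(`setLIntegral_le_two_mul_setLIntegral_ball`). In polar coordinates the integral over the ball is at
most C ψ(Ω^d S) min(1, (Ωr)^d); the sign of (d-1)/2 - α separates the three cases of ψ.

Lower bound: |φ|^* is a superposition of indicators of balls, so the right-hand side dominates M
once the oscillating kernel of order ν = β + d/2 has integral at least c min(1, (Ωr)^d) over every
ball (`exists_le_integral_besselClifford`). In the borderline case ν = d-1 this rests on ∫_0^1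
J_{2μ}(2rτ) dτ = ∫_0^1 J_μ(rτ)² τ (1-τ²)^{-1/2} dτ with 2μ = d-1, which replaces a signed integrand
by a square (`integral_besselClifford_sq`); the energy estimate then bounds the mean of that square
from below. A larger order is a positive average of the borderline one, by Sonine's integral. This
is where β ≥ d/2 - 1 enters. -/

/-- The entire function `x ↦ ∑ (-x)^k / (k! Γ(ν+k+1))`, so that
`J_ν(r) = (r/2)^ν * besselClifford ν (r²/4)`. -/
noncomputable def besselClifford (ν x : ℝ) : ℝ :=
  ∑' k : ℕ, (-1) ^ k / (k.factorial * Real.Gamma (ν + k + 1)) * x ^ k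

/-- From ν + 2 > 1 on, each unit step multiplies Γ by a factor above 1. The term k = 0 is counted
separately, since ν + 1 may be less than 1. The bound dominates the series of `besselClifford` by an
exponential series. -/
theorem exists_inv_Gamma_add_nat_le {ν : ℝ} (hν : -1 < ν) :
    ∃ B : ℝ, 0 < B ∧ ∀ k : ℕ, (Real.Gamma (ν + k + 1))⁻¹ ≤ B := by
  have h1 : 0 < Real.Gamma (ν + 1) := Real.Gamma_pos_of_pos (by linarith)
  have h2 : 0 < Real.Gamma (ν + 2) := Real.Gamma_pos_of_pos (by linarith)
  have key : ∀ k : ℕ, Real.Gamma (ν + 2) ≤ Real.Gamma (ν + k + 2) := by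
    intro k
    induction k with
    | zero => simp
    | succ k ih =>
      have hk : (0 : ℝ) ≤ k := k.cast_nonneg
      have : ν + ((k + 1 : ℕ) : ℝ) + 2 = (ν + k + 2) + 1 := by push_cast; ring
      rw [this, Real.Gamma_add_one (by linarith)]
      nlinarith
  refine ⟨(Real.Gamma (ν + 1))⁻¹ + (Real.Gamma (ν + 2))⁻¹, by positivity, fun k => ?_⟩
  rcases k with _ | k
  · simp [h2.le]
  · have : ν + ((k + 1 : ℕ) : ℝ) + 1 = ν + k + 2 := by push_cast; ring
    rw [this]
    have := inv_anti₀ h2 (key k)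
    have : 0 < (Real.Gamma (ν + 1))⁻¹ := by positivity
    linarith

theorem Gamma_add_nat_pos {ν : ℝ} (hν : -1 < ν) (k : ℕ) : 0 < Real.Gamma (ν + k + 1) := by
  have hk : (0 : ℝ) ≤ k := k.cast_nonneg
  exact Real.Gamma_pos_of_pos (by linarith)

theorem besselClifford_summable_abs {ν : ℝ} (hν : -1 < ν) (x : ℝ) :
    Summable fun k : ℕ => |(-1) ^ k / (k.factorial * Real.Gamma (ν + k + 1)) * x ^ k| := by
  obtain ⟨B, hB, h⟩ := exists_inv_Gamma_add_nat_le hν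
  refine Summable.of_nonneg_of_le (fun _ => abs_nonneg _) (fun k => ?_)
    ((Real.summable_pow_div_factorial |x|).mul_left B)
  have hG := Gamma_add_nat_pos hν k
  rw [abs_mul, abs_div, abs_pow, abs_neg, abs_one, one_pow, abs_pow, abs_mul, Nat.abs_cast,
    abs_of_pos hG]
  have : 1 / (k.factorial * Real.Gamma (ν + k + 1)) * |x| ^ k
      = (Real.Gamma (ν + k + 1))⁻¹ * (|x| ^ k / k.factorial) := by
    field_simp
  rw [this]
  exact mul_le_mul_of_nonneg_right (h k) (by positivity)

theorem besselClifford_summable {ν : ℝ} (hν : -1 < ν) (x : ℝ) :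
    Summable fun k : ℕ => (-1) ^ k / (k.factorial * Real.Gamma (ν + k + 1)) * x ^ k :=
  (besselClifford_summable_abs hν x).of_abs

theorem besselClifford_zero (ν : ℝ) : besselClifford ν 0 = (Real.Gamma (ν + 1))⁻¹ := by
  rw [besselClifford, tsum_eq_single 0 (by intro k hk; simp [hk])]
  simp

/-- Termwise differentiation on the ball of radius |x| + 1, where the differentiated series has a
summable majorant; the index shift k ↦ k + 1 raises the order by one. -/
theorem hasDerivAt_besselClifford {ν : ℝ} (hν : -1 < ν) (x : ℝ) :
    HasDerivAt (besselClifford ν) (-besselClifford (ν + 1) x) x := by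
  obtain ⟨B, hB, h⟩ := exists_inv_Gamma_add_nat_le hν
  set M := |x| + 1 with hM
  have hMpos : 0 < M := by positivity
  have hsum : Summable fun k : ℕ => B * (k * M ^ (k - 1) / k.factorial) := by
    refine Summable.mul_left B ?_
    rw [← summable_nat_add_iff 1]
    refine (Real.summable_pow_div_factorial M).congr fun k => ?_
    rw [Nat.factorial_succ]
    push_cast
    have : (k : ℝ) + 1 ≠ 0 := by positivity
    field_simp
  have := hasDerivAt_tsum_of_isPreconnected (𝕜 := ℝ) (F := ℝ)
    (g := fun (k : ℕ) (y : ℝ) => (-1) ^ k / (k.factorial * Real.Gamma (ν + k + 1)) * y ^ k)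
    (g' := fun (k : ℕ) (y : ℝ) =>
      (-1) ^ k / (k.factorial * Real.Gamma (ν + k + 1)) * (k * y ^ (k - 1)))
    (t := Metric.ball 0 M) (y₀ := x) (y := x)
    hsum Metric.isOpen_ball (convex_ball 0 M).isPreconnected
    (fun k y _ => (hasDerivAt_pow k y).const_mul _) ?_ (by simp [hM])
    (besselClifford_summable hν x) (by simp [hM])
  · convert! this using 1
    rw [besselClifford, ← tsum_neg]
    have hs : Summable (fun k : ℕ =>
        (-1) ^ k / (k.factorial * Real.Gamma (ν + k + 1)) * (k * x ^ (k - 1))) := by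
      rw [← summable_nat_add_iff 1]
      refine (besselClifford_summable (ν := ν + 1) (by linarith) x).neg.congr fun k => ?_
      rw [Nat.factorial_succ]
      have e : ν + ((k + 1 : ℕ) : ℝ) + 1 = ν + 1 + k + 1 := by push_cast; ring
      rw [e]
      push_cast
      have := (Gamma_add_nat_pos (ν := ν + 1) (by linarith) k).ne'
      have : (k : ℝ) + 1 ≠ 0 := by positivity
      field_simp
      ring
    rw [hs.tsum_eq_zero_add]
    simp only [Nat.cast_zero, zero_mul, mul_zero, zero_add]
    refine tsum_congr fun k => ?_
    rw [Nat.factorial_succ]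
    have e : ν + ((k + 1 : ℕ) : ℝ) + 1 = ν + 1 + k + 1 := by push_cast; ring
    rw [e]
    push_cast
    have := (Gamma_add_nat_pos (ν := ν + 1) (by linarith) k).ne'
    have : (k : ℝ) + 1 ≠ 0 := by positivity
    field_simp
    ring
  · intro k y hy
    have hy' : |y| ≤ M := by simpa using (Metric.mem_ball.1 hy).le
    have hG := Gamma_add_nat_pos hν k
    rw [Real.norm_eq_abs, abs_mul, abs_div, abs_pow, abs_neg, abs_one, one_pow, abs_mul,
      abs_mul, Nat.abs_cast, Nat.abs_cast, abs_of_pos hG, abs_pow]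
    have : 1 / (k.factorial * Real.Gamma (ν + k + 1)) * (k * |y| ^ (k - 1))
      = (Real.Gamma (ν + k + 1))⁻¹ * (k * |y| ^ (k - 1) / k.factorial) := by
      field_simp
    rw [this]
    exact mul_le_mul (h k) (by gcongr) (by positivity) hB.le

theorem continuous_besselClifford {ν : ℝ} (hν : -1 < ν) : Continuous (besselClifford ν) :=
  continuous_iff_continuousAt.2 fun x => (hasDerivAt_besselClifford hν x).continuousAt

/-- The classical three-term recurrence, which is Γ(s+1) = sΓ(s) in each coefficient. It closes the
derivative rule into Bessel's equation. -/
theorem besselClifford_recurrence {ν : ℝ} (hν : -1 < ν) (x : ℝ) :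
    besselClifford ν x = (ν + 1) * besselClifford (ν + 1) x - x * besselClifford (ν + 2) x := by
  have h0 := besselClifford_summable hν x
  have h1 := besselClifford_summable (ν := ν + 1) (by linarith) x
  have h2 := besselClifford_summable (ν := ν + 2) (by linarith) x
  have h1' := (h1.mul_left (ν + 1))
  simp only [besselClifford]
  rw [← tsum_mul_left, ← tsum_mul_left, h0.tsum_eq_zero_add, h1'.tsum_eq_zero_add, add_sub_assoc,
    ← Summable.tsum_sub ((summable_nat_add_iff 1).2 h1') (h2.mul_left x)]
  congr 1
  · have := Real.Gamma_add_one (s := ν + 1) (by linarith)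
    have hG : Real.Gamma (ν + 1) ≠ 0 := (Real.Gamma_pos_of_pos (by linarith)).ne'
    have h3 : ν + 1 ≠ 0 := by linarith
    simp only [Nat.cast_zero, add_zero, this]
    field_simp
  · refine tsum_congr fun k => ?_
    have hk : (0 : ℝ) ≤ k := k.cast_nonneg
    have e1 : ν + ((k + 1 : ℕ) : ℝ) + 1 = ν + k + 2 := by push_cast; ring
    have e2 : ν + 1 + ((k + 1 : ℕ) : ℝ) + 1 = (ν + k + 2) + 1 := by push_cast; ring
    have e3 : ν + 2 + (k : ℝ) + 1 = (ν + k + 2) + 1 := by ring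
    have hs : ν + k + 2 ≠ 0 := by linarith
    have hG : Real.Gamma (ν + k + 2) ≠ 0 := (Real.Gamma_pos_of_pos (by linarith)).ne'
    rw [e1, e2, e3, Real.Gamma_add_one hs, Nat.factorial_succ]
    push_cast
    have : (k : ℝ) + 1 ≠ 0 := by positivity
    field_simp
    ring

/-! ### Beta integrals -/

theorem integrableOn_betaIntegrand {a q : ℝ} (ha : 0 < a) (hq : 0 < q) :
    IntegrableOn (fun y : ℝ => y ^ (a - 1) * (1 - y) ^ (q - 1)) (Ioo 0 1) := by
  have h := Complex.betaIntegral_convergent (u := a) (v := q) (by simpa) (by simpa)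
  rw [intervalIntegrable_iff_integrableOn_Ioo_of_le (by simp)] at h
  refine IntegrableOn.congr_fun (f := fun x : ℝ => RCLike.re ((x : ℂ) ^ ((a : ℂ) - 1) * (1 - (x : ℂ)) ^ ((q : ℂ) - 1)))
    h.re (fun x hx => ?_) measurableSet_Ioo
  have h1 : (0 : ℝ) ≤ x := hx.1.le
  have h2 : (0 : ℝ) ≤ 1 - x := by linarith [hx.2]
  beta_reduce
  rw [show ((a : ℂ) - 1) = ((a - 1 : ℝ) : ℂ) by push_cast; ring,
    show ((q : ℂ) - 1) = ((q - 1 : ℝ) : ℂ) by push_cast; ring,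
    show ((1 : ℂ) - x) = ((1 - x : ℝ) : ℂ) by push_cast; ring,
    ← Complex.ofReal_cpow h1, ← Complex.ofReal_cpow h2, ← Complex.ofReal_mul]
  simp

theorem integral_betaIntegrand {a q : ℝ} (ha : 0 < a) (hq : 0 < q) :
    ∫ y in Ioo (0 : ℝ) 1, y ^ (a - 1) * (1 - y) ^ (q - 1) = beta a q := by
  rw [beta_eq_betaIntegralReal a q ha hq, Complex.betaIntegral,
    intervalIntegral.integral_of_le (by norm_num), integral_Ioc_eq_integral_Ioo,
    ← RCLike.re_to_complex]
  have h := Complex.betaIntegral_convergent (u := a) (v := q) (by simpa) (by simpa)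
  rw [intervalIntegrable_iff_integrableOn_Ioo_of_le (by simp)] at h
  rw [← integral_re h]
  refine setIntegral_congr_fun measurableSet_Ioo (fun x hx => ?_)
  have h1 : (0 : ℝ) ≤ x := hx.1.le
  have h2 : (0 : ℝ) ≤ 1 - x := by linarith [hx.2]
  rw [show ((a : ℂ) - 1) = ((a - 1 : ℝ) : ℂ) by push_cast; ring,
    show ((q : ℂ) - 1) = ((q - 1 : ℝ) : ℂ) by push_cast; ring,
    show ((1 : ℂ) - x) = ((1 - x : ℝ) : ℂ) by push_cast; ring,
    ← Complex.ofReal_cpow h1, ← Complex.ofReal_cpow h2, ← Complex.ofReal_mul]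
  simp

/-- The substitution y = τ² with its Jacobian. Indicators are used because the change of variables
for powers lives on the whole half-line. -/
theorem indicator_Ioo_sq_eq {a q x : ℝ} (hx : x ∈ Ioi (0 : ℝ)) :
    (2 * x ^ ((2 : ℝ) - 1)) •
      (Ioo (0 : ℝ) 1).indicator (fun y : ℝ => y ^ (a - 1) * (1 - y) ^ (q - 1)) (x ^ (2 : ℝ)) =
    (Ioo (0 : ℝ) 1).indicator
      (fun τ : ℝ => 2 * (τ ^ (2 * a - 1) * (1 - τ ^ 2) ^ (q - 1))) x := by
  have hx0 : (0 : ℝ) < x := hx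
  have hm : x ^ (2 : ℝ) ∈ Ioo (0 : ℝ) 1 ↔ x ∈ Ioo (0 : ℝ) 1 := by
    rw [Real.rpow_two]
    constructor
    · rintro ⟨_, h⟩; exact ⟨hx0, by nlinarith⟩
    · rintro ⟨_, h⟩; exact ⟨by positivity, by nlinarith⟩
  by_cases h : x ∈ Ioo (0 : ℝ) 1
  · rw [indicator_of_mem h, indicator_of_mem (hm.2 h), smul_eq_mul, ← Real.rpow_mul hx0.le,
      Real.rpow_two, show 2 * a - 1 = (2 - 1) + 2 * (a - 1) by ring,
      Real.rpow_add hx0 (2 - 1)]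
    ring
  · rw [indicator_of_notMem h, indicator_of_notMem (fun h' => h (hm.1 h')), smul_zero]

theorem integrableOn_betaIntegrand_sq {a q : ℝ} (ha : 0 < a) (hq : 0 < q) :
    IntegrableOn (fun τ : ℝ => τ ^ (2 * a - 1) * (1 - τ ^ 2) ^ (q - 1)) (Ioo 0 1) := by
  have h := integrableOn_betaIntegrand ha hq
  rw [← integrable_indicator_iff measurableSet_Ioo] at h
  have h2 := (integrableOn_Ioi_comp_rpow_iff
    ((Ioo (0 : ℝ) 1).indicator fun y : ℝ => y ^ (a - 1) * (1 - y) ^ (q - 1))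
    (p := 2) two_ne_zero).2 h.integrableOn
  rw [abs_of_pos (two_pos : (0 : ℝ) < 2),
    integrableOn_congr_fun (fun x hx => indicator_Ioo_sq_eq hx) measurableSet_Ioi] at h2
  rw [IntegrableOn, integrable_indicator_iff measurableSet_Ioo, IntegrableOn,
    Measure.restrict_restrict measurableSet_Ioo,
    inter_eq_self_of_subset_left Ioo_subset_Ioi_self] at h2
  exact (h2.const_mul (1 / 2)).congr (by filter_upwards with x; ring)

theorem integral_betaIntegrand_sq {a q : ℝ} (ha : 0 < a) (hq : 0 < q) :
    ∫ τ in Ioo (0 : ℝ) 1, τ ^ (2 * a - 1) * (1 - τ ^ 2) ^ (q - 1) = beta a q / 2 := by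
  have h := integral_comp_rpow_Ioi_of_pos (p := 2)
    (g := (Ioo (0 : ℝ) 1).indicator fun y : ℝ => y ^ (a - 1) * (1 - y) ^ (q - 1)) two_pos
  rw [setIntegral_congr_fun measurableSet_Ioi (fun x hx => indicator_Ioo_sq_eq hx),
    setIntegral_indicator measurableSet_Ioo, setIntegral_indicator measurableSet_Ioo,
    inter_eq_self_of_subset_right Ioo_subset_Ioi_self, integral_betaIntegrand ha hq,
    integral_const_mul] at h
  linarith

/-- Termwise integration is allowed because τ^{2k} ≤ 1 on (0,1). The Bessel integral identities
below follow by applying this to the series involved and comparing coefficients. -/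
theorem hasSum_integral_tsum_betaIntegrand {c : ℕ → ℝ} (hc : Summable fun k => |c k|) {a q : ℝ}
    (ha : 0 < a) (hq : 0 < q) :
    HasSum (fun k : ℕ => c k * (beta (a + k) q / 2))
      (∫ τ in Ioo (0 : ℝ) 1,
        (∑' k : ℕ, c k * (τ ^ 2) ^ k) * (τ ^ (2 * a - 1) * (1 - τ ^ 2) ^ (q - 1))) := by
  have hpos : ∀ k : ℕ, 0 < a + k := fun k => by positivity
  have hF : ∀ k : ℕ, Integrable (fun τ : ℝ =>
      c k * (τ ^ (2 * (a + k) - 1) * (1 - τ ^ 2) ^ (q - 1))) (volume.restrict (Ioo 0 1)) :=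
    fun k => (integrableOn_betaIntegrand_sq (hpos k) hq).const_mul _
  have hnorm : ∀ k : ℕ, ∫ τ in Ioo (0 : ℝ) 1,
      ‖c k * (τ ^ (2 * (a + k) - 1) * (1 - τ ^ 2) ^ (q - 1))‖ ≤ |c k| * (beta a q / 2) := by
    intro k
    rw [← integral_betaIntegrand_sq ha hq, ← integral_const_mul]
    refine setIntegral_mono_on (hF k).norm
      ((integrableOn_betaIntegrand_sq ha hq).const_mul _) measurableSet_Ioo fun τ hτ => ?_
    have h2 : 0 ≤ 1 - τ ^ 2 := by nlinarith [hτ.1, hτ.2]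
    have h0 : 0 ≤ τ := hτ.1.le
    rw [Real.norm_eq_abs, abs_mul, abs_of_nonneg (a := _ * _) (by positivity)]
    refine mul_le_mul_of_nonneg_left (mul_le_mul_of_nonneg_right ?_ (by positivity)) (by positivity)
    refine Real.rpow_le_rpow_of_exponent_ge hτ.1 hτ.2.le ?_
    have : (0 : ℝ) ≤ k := k.cast_nonneg
    linarith
  have key := hasSum_integral_of_summable_integral_norm hF
    (Summable.of_nonneg_of_le (fun _ => integral_nonneg fun _ => norm_nonneg _) hnorm
      (hc.mul_right _))
  convert! key using 1
  · funext k
    rw [integral_const_mul, integral_betaIntegrand_sq (hpos k) hq]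
  · refine setIntegral_congr_fun measurableSet_Ioo fun τ hτ => ?_
    rw [← tsum_mul_right]
    refine tsum_congr fun k => ?_
    rw [show 2 * (a + k) - 1 = ((2 * k : ℕ) : ℝ) + (2 * a - 1) by push_cast; ring,
      Real.rpow_add hτ.1, Real.rpow_natCast, pow_mul]
    ring

/-- Sonine's first integral. -/
theorem integral_besselClifford_sonine {μ ν : ℝ} (hμ : -1 < μ) (hμν : μ < ν) (x : ℝ) :
    ∫ τ in Ioo (0 : ℝ) 1, besselClifford μ (x * τ ^ 2) *
      (τ ^ (2 * μ + 1) * (1 - τ ^ 2) ^ (ν - μ - 1)) =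
      Real.Gamma (ν - μ) / 2 * besselClifford ν x := by
  have h := hasSum_integral_tsum_betaIntegrand (besselClifford_summable_abs hμ x)
    (a := μ + 1) (q := ν - μ) (by linarith) (by linarith)
  have h2 := (besselClifford_summable (ν := ν) (by linarith) x).hasSum.mul_left
    (Real.Gamma (ν - μ) / 2)
  rw [show 2 * (μ + 1) - 1 = 2 * μ + 1 by ring] at h
  simp only [besselClifford, mul_pow x, ← mul_assoc _ (x ^ _)]
  refine h.unique ?_
  -- The beta value B(μ+k+1, ν-μ) turns Γ(μ+k+1) in the k-th coefficient into Γ(ν+k+1).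
  convert! h2 using 2 with k
  have h3 := (Gamma_add_nat_pos hμ k).ne'
  have h4 := (Gamma_add_nat_pos (ν := ν) (by linarith) k).ne'
  rw [beta, show μ + 1 + k = μ + k + 1 by ring, show μ + k + 1 + (ν - μ) = ν + k + 1 by ring]
  field_simp

/-- Legendre's duplication formula at k + 1/2 turns k! Γ(k+1/2) into √π (2k)! / 4^k. -/
theorem cos_eq_besselClifford (r : ℝ) :
    Real.cos r = √Real.pi * besselClifford (-1 / 2) (r ^ 2 / 4) := by
  have h := (besselClifford_summable (ν := -1 / 2) (by norm_num) (r ^ 2 / 4)).hasSum.mul_left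
    (√Real.pi)
  refine (Real.hasSum_cos r).unique ?_
  convert! h using 2 with k
  have h2 := Real.Gamma_mul_Gamma_add_half (k + 1 / 2)
  rw [show (k : ℝ) + 1 / 2 + 1 / 2 = k + 1 by ring, show 2 * ((k : ℝ) + 1 / 2) = (2 * k : ℕ) + 1 by
    push_cast; ring, Real.Gamma_nat_eq_factorial, Real.Gamma_nat_eq_factorial,
    show (1 : ℝ) - ((2 * k : ℕ) + 1) = -(2 * k : ℕ) by ring, Real.rpow_neg two_pos.le,
    Real.rpow_natCast, pow_mul] at h2
  have hG : 0 < Real.Gamma (k + 1 / 2) := Real.Gamma_pos_of_pos (by positivity)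
  have hf : (0 : ℝ) < k.factorial := by exact_mod_cast k.factorial_pos
  have hf2 : (0 : ℝ) < (2 * k).factorial := by exact_mod_cast (2 * k).factorial_pos
  rw [show (-1 / 2 : ℝ) + k + 1 = k + 1 / 2 by ring, mul_comm (k.factorial : ℝ), h2, div_pow, pow_mul]
  have : 0 < √Real.pi := by positivity
  field_simp
  norm_num

/-- Poisson's integral. -/
theorem integral_cos_mul_one_sub_sq_rpow {ν : ℝ} (hν : -1 / 2 < ν) (r : ℝ) :
    ∫ τ in Ioo (0 : ℝ) 1, Real.cos (r * τ) * (1 - τ ^ 2) ^ (ν - 1 / 2) =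
      √Real.pi * Real.Gamma (ν + 1 / 2) / 2 * besselClifford ν (r ^ 2 / 4) := by
  -- Poisson's integral is Sonine's from order -1/2: the kernel is a cosine and the weight τ^{2μ+1}
  -- is 1.
  have h := integral_besselClifford_sonine (μ := -1 / 2) (ν := ν) (by norm_num) hν (r ^ 2 / 4)
  rw [show ν - -1 / 2 = ν + 1 / 2 by ring, show ν + 1 / 2 - 1 = ν - 1 / 2 by ring] at h
  have h2 : ∀ τ : ℝ, Real.cos (r * τ) * (1 - τ ^ 2) ^ (ν - 1 / 2) = √Real.pi *
      (besselClifford (-1 / 2) (r ^ 2 / 4 * τ ^ 2) *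
        (τ ^ (2 * (-1 / 2 : ℝ) + 1) * (1 - τ ^ 2) ^ (ν - 1 / 2))) := by
    intro τ
    rw [cos_eq_besselClifford, show (2 * (-1 / 2 : ℝ) + 1) = 0 by norm_num, Real.rpow_zero,
      mul_pow]
    ring_nf
  simp_rw [h2]
  rw [integral_const_mul, h]
  ring

/-! ### The square of a Bessel function -/

theorem Gamma_add_one_eq_descPochhammer {x : ℝ} (k : ℕ) (hk : (k : ℝ) - 1 < x) :
    Real.Gamma (x + 1) = (descPochhammer ℤ k).smeval x * Real.Gamma (x - k + 1) := by
  induction k with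
  | zero => simp
  | succ k ih =>
    push_cast at hk ⊢
    rw [ih (by linarith), descPochhammer_succ_right, Polynomial.smeval_mul,
      Real.Gamma_add_one (by linarith : x - k ≠ 0)]
    simp [Polynomial.smeval_sub, Polynomial.smeval_natCast]
    ring_nf

/-- Brings Gamma quotients into a form to which Vandermonde's identity with real upper arguments
applies. -/
theorem choose_eq_Gamma_div {x : ℝ} (k : ℕ) (hk : (k : ℝ) - 1 < x) :
    Ring.choose x k = Real.Gamma (x + 1) / (k.factorial * Real.Gamma (x - k + 1)) := by
  have hG : Real.Gamma (x - k + 1) ≠ 0 := (Real.Gamma_pos_of_pos (by linarith)).ne'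
  have hf : (k.factorial : ℝ) ≠ 0 := by exact_mod_cast k.factorial_ne_zero
  rw [Gamma_add_one_eq_descPochhammer k hk, Ring.choose_eq_smul, smul_eq_mul]
  field_simp

/-- Vandermonde's identity with both upper arguments equal to μ + m: since i + j = m, the lower
Gamma values Γ(μ+m-i+1) and Γ(μ+m-j+1) become Γ(μ+j+1) and Γ(μ+i+1). -/
theorem sum_antidiagonal_inv_Gamma {μ : ℝ} (hμ : -1 / 2 < μ) (m : ℕ) :
    ∑ ij ∈ Finset.HasAntidiagonal.antidiagonal m, 1 / (ij.1.factorial * Real.Gamma (μ + ij.1 + 1)) *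
        (1 / (ij.2.factorial * Real.Gamma (μ + ij.2 + 1))) =
      Real.Gamma (2 * μ + 2 * m + 1) /
        (m.factorial * Real.Gamma (2 * μ + m + 1) * Real.Gamma (μ + m + 1) ^ 2) := by
  have hm : (0 : ℝ) ≤ m := m.cast_nonneg
  have hv := Ring.add_choose_eq (r := μ + m) (s := μ + m) m (Commute.refl _)
  have hG := (Gamma_add_nat_pos (ν := μ) (by linarith) m).ne'
  have hG2 : Real.Gamma (2 * μ + m + 1) ≠ 0 :=
    (Gamma_add_nat_pos (ν := 2 * μ) (by linarith) m).ne'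
  rw [choose_eq_Gamma_div m (by linarith),
    show μ + m + (μ + m) - m + 1 = 2 * μ + m + 1 by ring,
    show μ + m + (μ + m) + 1 = 2 * μ + 2 * m + 1 by ring] at hv
  have hs : ∀ ij ∈ Finset.HasAntidiagonal.antidiagonal m, Ring.choose (μ + m) ij.1 * Ring.choose (μ + m) ij.2 =
      Real.Gamma (μ + m + 1) ^ 2 * (1 / (ij.1.factorial * Real.Gamma (μ + ij.1 + 1)) *
        (1 / (ij.2.factorial * Real.Gamma (μ + ij.2 + 1)))) := by
    rintro ⟨i, j⟩ hij
    have hij' : (i : ℝ) + j = m := by exact_mod_cast Finset.HasAntidiagonal.mem_antidiagonal.1 hij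
    have hi : (0 : ℝ) ≤ i := i.cast_nonneg
    have hj : (0 : ℝ) ≤ j := j.cast_nonneg
    simp only
    rw [choose_eq_Gamma_div i (by linarith), choose_eq_Gamma_div j (by linarith),
      show μ + m - i + 1 = μ + j + 1 by linarith, show μ + m - j + 1 = μ + i + 1 by linarith]
    have h1 := (Gamma_add_nat_pos (ν := μ) (by linarith) i).ne'
    have h2 := (Gamma_add_nat_pos (ν := μ) (by linarith) j).ne'
    have h3 : (i.factorial : ℝ) ≠ 0 := by exact_mod_cast i.factorial_ne_zero
    have h4 : (j.factorial : ℝ) ≠ 0 := by exact_mod_cast j.factorial_ne_zero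
    field_simp
  rw [Finset.sum_congr rfl hs, ← Finset.mul_sum] at hv
  have hf : (m.factorial : ℝ) ≠ 0 := by exact_mod_cast m.factorial_ne_zero
  field_simp at hv ⊢
  linarith

theorem besselClifford_sq {μ : ℝ} (hμ : -1 / 2 < μ) (x : ℝ) :
    (Summable fun m : ℕ => |(-1) ^ m * (Real.Gamma (2 * μ + 2 * m + 1) /
      (m.factorial * Real.Gamma (2 * μ + m + 1) * Real.Gamma (μ + m + 1) ^ 2)) * x ^ m|) ∧
    besselClifford μ x ^ 2 = ∑' m : ℕ, (-1) ^ m * (Real.Gamma (2 * μ + 2 * m + 1) /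
      (m.factorial * Real.Gamma (2 * μ + m + 1) * Real.Gamma (μ + m + 1) ^ 2)) * x ^ m := by
  have hs := besselClifford_summable_abs (ν := μ) (by linarith) x
  have key : ∀ m : ℕ, ∑ ij ∈ Finset.HasAntidiagonal.antidiagonal m,
      ((-1) ^ ij.1 / (ij.1.factorial * Real.Gamma (μ + ij.1 + 1)) * x ^ ij.1) *
        ((-1) ^ ij.2 / (ij.2.factorial * Real.Gamma (μ + ij.2 + 1)) * x ^ ij.2) =
      (-1) ^ m * (Real.Gamma (2 * μ + 2 * m + 1) /
      (m.factorial * Real.Gamma (2 * μ + m + 1) * Real.Gamma (μ + m + 1) ^ 2)) * x ^ m := by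
    intro m
    rw [← sum_antidiagonal_inv_Gamma hμ, Finset.mul_sum, Finset.sum_mul]
    refine Finset.sum_congr rfl fun ij hij => ?_
    rw [← Finset.HasAntidiagonal.mem_antidiagonal.1 hij, pow_add, pow_add]
    ring
  set f : ℕ → ℝ := fun k => (-1) ^ k / (k.factorial * Real.Gamma (μ + k + 1)) * x ^ k with hf
  have hs' : Summable fun k => ‖f k‖ := hs
  have h1 := summable_norm_sum_mul_antidiagonal_of_summable_norm hs' hs'
  have h2 := tsum_mul_tsum_eq_tsum_sum_antidiagonal_of_summable_norm hs' hs'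
  constructor
  · exact h1.congr fun m => by rw [Real.norm_eq_abs, key m]
  · rw [sq]
    exact h2.trans (tsum_congr key)

/-- In classical notation, ∫_0^1 J_μ(rτ)² τ (1-τ²)^{-1/2} dτ = ∫_0^1 J_{2μ}(2rτ) dτ, the source of
positivity. Both sides are integrated termwise, and duplication at μ + m + 1/2 matches the
coefficients. -/
theorem integral_besselClifford_sq {μ : ℝ} (hμ : -1 / 2 < μ) (x : ℝ) :
    ∫ τ in Ioo (0 : ℝ) 1, besselClifford μ (x * τ ^ 2) ^ 2 *
      (τ ^ (2 * μ + 1) * (1 - τ ^ 2) ^ (-1 / 2 : ℝ)) =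
    4 ^ μ * ∫ τ in Ioo (0 : ℝ) 1, besselClifford (2 * μ) (4 * x * τ ^ 2) * τ ^ (2 * μ) := by
  have h1 := hasSum_integral_tsum_betaIntegrand (besselClifford_sq hμ x).1
    (a := μ + 1) (q := 1 / 2) (by linarith) (by norm_num)
  have h2 := (hasSum_integral_tsum_betaIntegrand (besselClifford_summable_abs
    (ν := 2 * μ) (by linarith) (4 * x)) (a := μ + 1 / 2) (q := 1)
    (by linarith) (by norm_num)).mul_left (4 ^ μ : ℝ)
  rw [show 2 * (μ + 1) - 1 = 2 * μ + 1 by ring, show (1 / 2 - 1 : ℝ) = -1 / 2 by norm_num] at h1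
  simp only [show 2 * (μ + 1 / 2) - 1 = 2 * μ by ring, sub_self, Real.rpow_zero, mul_one,
    mul_assoc, ← mul_pow] at h2
  simp only [mul_assoc, ← mul_pow] at h1
  have e : ∀ τ : ℝ, besselClifford μ (x * τ ^ 2) ^ 2 = _ :=
    fun τ => (besselClifford_sq hμ (x * τ ^ 2)).2
  simp only [e]
  simp only [besselClifford, mul_assoc]
  refine h1.unique ?_
  convert! h2 using 2 with m
  have hm : (0 : ℝ) ≤ m := m.cast_nonneg
  have hG1 : 0 < Real.Gamma (μ + m + 1 / 2) := Real.Gamma_pos_of_pos (by linarith)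
  have hG2 : 0 < Real.Gamma (μ + m + 1) := Real.Gamma_pos_of_pos (by linarith)
  have hG3 : 0 < Real.Gamma (2 * μ + m + 1) := Real.Gamma_pos_of_pos (by linarith)
  have hf : (0 : ℝ) < m.factorial := by exact_mod_cast m.factorial_pos
  have hp : μ + m + 1 / 2 ≠ 0 := by linarith
  have hd := Real.Gamma_mul_Gamma_add_half (μ + m + 1 / 2)
  rw [show μ + m + 1 / 2 + 1 / 2 = μ + m + 1 by ring,
    show 2 * (μ + m + 1 / 2) = 2 * μ + 2 * m + 1 by ring,
    show 1 - (2 * μ + 2 * m + 1) = -(2 * (μ + m)) by ring, Real.rpow_neg two_pos.le,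
    Real.rpow_mul two_pos.le, Real.rpow_two, Real.rpow_add (by norm_num), Real.rpow_natCast] at hd
  norm_num at hd
  have hpi : 0 < √Real.pi := by positivity
  have h4 : (0 : ℝ) < 4 ^ μ := by positivity
  have hd' : Real.Gamma (2 * μ + 2 * m + 1) =
      Real.Gamma (μ + m + 1 / 2) * Real.Gamma (μ + m + 1) * (4 ^ μ * 4 ^ m) / √Real.pi := by
    field_simp at hd ⊢
    linarith
  rw [beta, beta, show μ + 1 + m = μ + m + 1 by ring, show μ + 1 / 2 + m = μ + m + 1 / 2 by ring,
    show μ + m + 1 + 1 / 2 = μ + m + 1 / 2 + 1 by ring, Real.Gamma_add_one hp, hd',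
    Real.Gamma_one_half_eq, Real.Gamma_one, mul_pow]
  field_simp

/-! ### Energy estimates for `y'' = (k / r² - 1) y` -/

/-- With E = y² + z², E' = 2kyz/r² is at most |k|E/r² in absolute value, so E e^{|k|/r} decreases
and E e^{-|k|/r} increases. -/
theorem energy_le_and_ge {y z : ℝ → ℝ} {k : ℝ} (hy : ∀ r, 0 < r → HasDerivAt y (z r) r)
    (hz : ∀ r, 0 < r → HasDerivAt z ((k / r ^ 2 - 1) * y r) r) {a b : ℝ} (ha : 0 < a)
    (hab : a ≤ b) :
    y b ^ 2 + z b ^ 2 ≤ (y a ^ 2 + z a ^ 2) * Real.exp (|k| / a) ∧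
      (y a ^ 2 + z a ^ 2) * Real.exp (-|k| / a) ≤ y b ^ 2 + z b ^ 2 := by
  have hd : ∀ l r : ℝ, 0 < r → HasDerivAt (fun r => (y r ^ 2 + z r ^ 2) * Real.exp (l / r))
      ((2 * (y r * z r) * k - l * (y r ^ 2 + z r ^ 2)) / r ^ 2 * Real.exp (l / r)) r := by
    intro l r hr
    have h1 := (((hy r hr).pow 2).add ((hz r hr).pow 2)).mul
      ((hasDerivAt_inv hr.ne').const_mul l).exp
    simp only [← div_eq_mul_inv] at h1
    convert! h1 using 1
    simp only [Pi.add_apply, Pi.pow_apply]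
    field_simp
    ring
  have hbound : ∀ r, |2 * (y r * z r) * k| ≤ |k| * (y r ^ 2 + z r ^ 2) := by
    intro r
    have h1 : |2 * (y r * z r)| ≤ y r ^ 2 + z r ^ 2 := by
      rw [abs_le]; constructor <;> nlinarith [sq_nonneg (y r + z r), sq_nonneg (y r - z r)]
    rw [abs_mul, mul_comm |k|]
    gcongr
  have hint : interior (Ioi (0 : ℝ)) = Ioi 0 := interior_Ioi
  have hb : 0 < b := ha.trans_le hab
  have hcont : ∀ l : ℝ, ContinuousOn (fun r => (y r ^ 2 + z r ^ 2) * Real.exp (l / r)) (Ioi 0) :=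
    fun l r hr => (hd l r hr).continuousAt.continuousWithinAt
  constructor
  · have hanti : AntitoneOn (fun r => (y r ^ 2 + z r ^ 2) * Real.exp (|k| / r)) (Ioi 0) := by
      refine antitoneOn_of_deriv_nonpos (convex_Ioi 0) (hcont _)
        (fun r hr => (hd _ r (by simpa using hr)).differentiableAt.differentiableWithinAt)
        fun r hr => ?_
      have hr0 : 0 < r := by simpa using hr
      rw [(hd _ r hr0).deriv]
      refine mul_nonpos_of_nonpos_of_nonneg (div_nonpos_of_nonpos_of_nonneg ?_ (by positivity))
        (by positivity)
      linarith [(abs_le.1 (hbound r)).2]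
    refine le_trans ?_ (hanti ha hb hab)
    exact le_mul_of_one_le_right (by positivity) (Real.one_le_exp (by positivity))
  · have hmono : MonotoneOn (fun r => (y r ^ 2 + z r ^ 2) * Real.exp (-|k| / r)) (Ioi 0) := by
      refine monotoneOn_of_deriv_nonneg (convex_Ioi 0) (hcont _)
        (fun r hr => (hd _ r (by simpa using hr)).differentiableAt.differentiableWithinAt)
        fun r hr => ?_
      have hr0 : 0 < r := by simpa using hr
      rw [(hd _ r hr0).deriv]
      refine mul_nonneg (div_nonneg ?_ (by positivity)) (by positivity)
      linarith [(abs_le.1 (hbound r)).1]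
    refine (hmono ha hb hab).trans ?_
    refine mul_le_of_le_one_right (by positivity) (Real.exp_le_one_iff.2 ?_)
    exact div_nonpos_of_nonpos_of_nonneg (by simp) hb.le

/-- Equipartition of energy: 2Y + yz has derivative y² + z² + k y²/r², at least half the energy once
r is large, while yz stays bounded. Hence ∫ y² grows linearly. -/
theorem exists_linear_le_primitive_sq {y z Y : ℝ → ℝ} {k : ℝ}
    (hy : ∀ r, 0 < r → HasDerivAt y (z r) r)
    (hz : ∀ r, 0 < r → HasDerivAt z ((k / r ^ 2 - 1) * y r) r)
    (hY : ∀ r, 0 < r → HasDerivAt Y (y r ^ 2) r) {a : ℝ} (ha : 0 < a)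
    (hpos : 0 < y a ^ 2 + z a ^ 2) :
    ∃ c r₁ : ℝ, 0 < c ∧ 0 < r₁ ∧ ∀ r, r₁ ≤ r → c * r ≤ Y r := by
  set e₀ := (y a ^ 2 + z a ^ 2) * Real.exp (-|k| / a) with he₀
  set M := (y a ^ 2 + z a ^ 2) * Real.exp (|k| / a) with hM
  have he₀pos : 0 < e₀ := by positivity
  -- Beyond b both r ≥ 1 and r ≥ 2|k|, so |k|/r² ≤ 1/2.
  set b := a + 1 + 2 * |k| with hb
  have hbpos : 0 < b := by positivity
  have hab : a ≤ b := by have := abs_nonneg k; linarith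
  have hD : ∀ r, 0 < r → HasDerivAt (fun r => 2 * Y r + y r * z r - e₀ / 2 * r)
      (2 * y r ^ 2 + (z r * z r + y r * ((k / r ^ 2 - 1) * y r)) - e₀ / 2 * 1) r := fun r hr =>
    (((hY r hr).const_mul 2).add ((hy r hr).mul (hz r hr))).sub
      ((hasDerivAt_id r).const_mul (e₀ / 2))
  have hmono : MonotoneOn (fun r => 2 * Y r + y r * z r - e₀ / 2 * r) (Ici b) := by
    refine monotoneOn_of_deriv_nonneg (convex_Ici b)
      (fun r hr => (hD r (hbpos.trans_le hr)).continuousAt.continuousWithinAt)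
      (fun r hr => (hD r (hbpos.trans (by simpa using hr))).differentiableAt.differentiableWithinAt)
      fun r hr => ?_
    have hbr : b < r := by simpa using hr
    have hr0 : 0 < r := hbpos.trans hbr
    rw [(hD r hr0).deriv]
    have he := (energy_le_and_ge hy hz ha (hab.trans hbr.le)).2
    have hk : |k / r ^ 2| ≤ 1 / 2 := by
      rw [abs_div, abs_of_pos (by positivity : (0 : ℝ) < r ^ 2), div_le_iff₀ (by positivity)]
      have : 1 ≤ r := by have := abs_nonneg k; linarith
      have : 2 * |k| ≤ r := by linarith
      nlinarith
    have := (abs_le.1 hk).1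
    nlinarith [sq_nonneg (y r), sq_nonneg (z r)]
  set D₀ := 2 * Y b + y b * z b - e₀ / 2 * b with hD₀
  -- The threshold makes M + |D₀|, the total of the bounded terms, at most e₀ r / 8.
  refine ⟨e₀ / 8, max b (8 * (M + |D₀|) / e₀), by positivity, lt_max_of_lt_left hbpos,
    fun r hr => ?_⟩
  have hbr : b ≤ r := (le_max_left _ _).trans hr
  have h1 : D₀ ≤ 2 * Y r + y r * z r - e₀ / 2 * r := hmono self_mem_Ici hbr hbr
  have h2 := (energy_le_and_ge hy hz ha (hab.trans hbr)).1
  have h3 : M + |D₀| ≤ e₀ * r / 8 := by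
    have := (le_max_right b (8 * (M + |D₀|) / e₀)).trans hr
    rw [div_le_iff₀ he₀pos] at this
    linarith
  have h4 : y r * z r ≤ M := by nlinarith [sq_nonneg (y r - z r), sq_nonneg (y r + z r)]
  have h5 := neg_abs_le D₀
  have h6 : 0 < e₀ * r := mul_pos he₀pos (hbpos.trans_le hbr)
  linarith

/-! ### The Bessel equation -/

theorem hasDerivAt_besselClifford_sq_div {ν : ℝ} (hν : -1 < ν) (r : ℝ) :
    HasDerivAt (fun r : ℝ => besselClifford ν (r ^ 2 / 4))
      (-besselClifford (ν + 1) (r ^ 2 / 4) * (r / 2)) r := by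
  have h := (hasDerivAt_besselClifford hν (r ^ 2 / 4)).comp r ((hasDerivAt_pow 2 r).div_const 4)
  convert! h using 1
  norm_num
  left
  ring

/-- The function is 2^ν √r J_ν(r); the factor √r removes the first-order term from Bessel's equation
and puts it in the form of the energy estimates. -/
theorem hasDerivAt_rpow_mul_besselClifford {ν : ℝ} (hν : -1 < ν) {r : ℝ} (hr : 0 < r) :
    HasDerivAt (fun r : ℝ => r ^ (ν + 1 / 2) * besselClifford ν (r ^ 2 / 4))
      ((ν + 1 / 2) * r ^ (ν - 1 / 2) * besselClifford ν (r ^ 2 / 4) -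
        r ^ (ν + 3 / 2) / 2 * besselClifford (ν + 1) (r ^ 2 / 4)) r := by
  have h := (Real.hasDerivAt_rpow_const (p := ν + 1 / 2) (Or.inl hr.ne')).mul
    (hasDerivAt_besselClifford_sq_div hν r)
  convert! h using 1
  rw [show ν + 1 / 2 - 1 = ν - 1 / 2 by ring, show ν + 3 / 2 = ν + 1 / 2 + 1 by ring,
    Real.rpow_add_one hr.ne']
  ring

theorem hasDerivAt_deriv_rpow_mul_besselClifford {ν : ℝ} (hν : -1 < ν) {r : ℝ} (hr : 0 < r) :
    HasDerivAt (fun r : ℝ => (ν + 1 / 2) * r ^ (ν - 1 / 2) * besselClifford ν (r ^ 2 / 4) -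
        r ^ (ν + 3 / 2) / 2 * besselClifford (ν + 1) (r ^ 2 / 4))
      (((ν ^ 2 - 1 / 4) / r ^ 2 - 1) * (r ^ (ν + 1 / 2) * besselClifford ν (r ^ 2 / 4))) r := by
  have h1 := ((Real.hasDerivAt_rpow_const (p := ν - 1 / 2) (Or.inl hr.ne')).const_mul
    (ν + 1 / 2)).mul (hasDerivAt_besselClifford_sq_div hν r)
  have h2 := ((Real.hasDerivAt_rpow_const (p := ν + 3 / 2) (Or.inl hr.ne')).div_const 2).mul
    (hasDerivAt_besselClifford_sq_div (ν := ν + 1) (by linarith) r)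
  convert! h1.sub h2 using 1
  have e0 : r ^ (ν + 3 / 2) = r ^ (ν - 3 / 2) * r ^ 3 := by
    rw [← Real.rpow_natCast, ← Real.rpow_add hr]; congr 1; push_cast; ring
  have e1 : r ^ (ν + 1 / 2) = r ^ (ν - 3 / 2) * r ^ 2 := by
    rw [← Real.rpow_natCast, ← Real.rpow_add hr]; congr 1; push_cast; ring
  have e2 : r ^ (ν - 1 / 2) = r ^ (ν - 3 / 2) * r := by
    rw [← Real.rpow_add_one hr.ne']; congr 1; ring
  rw [show ν + 3 / 2 - 1 = ν + 1 / 2 by ring, show ν - 1 / 2 - 1 = ν - 3 / 2 by ring, e0, e1, e2,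
    besselClifford_recurrence hν, show ν + 1 + 1 = ν + 2 by ring]
  field_simp
  ring

theorem exists_pos_besselClifford_ne_zero {ν : ℝ} (hν : -1 < ν) :
    ∃ δ : ℝ, 0 < δ ∧ ∀ x, |x| ≤ δ → besselClifford ν x ≠ 0 := by
  have h0 : besselClifford ν 0 ≠ 0 := by
    rw [besselClifford_zero]
    exact inv_ne_zero (Real.Gamma_pos_of_pos (by linarith)).ne'
  have := (continuous_besselClifford hν).continuousAt.eventually_ne h0
  obtain ⟨δ, hδ, h⟩ := Metric.eventually_nhds_iff_ball.1 this
  refine ⟨δ / 2, by positivity, fun x hx => h x ?_⟩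
  rw [mem_ball_zero_iff, Real.norm_eq_abs]
  linarith

/-- The decay of the Bessel functions. -/
theorem exists_abs_besselClifford_le {ν : ℝ} (hν : -1 / 2 ≤ ν) :
    ∃ C : ℝ, 0 < C ∧ ∀ r : ℝ, 0 ≤ r →
      |besselClifford ν (r ^ 2 / 4)| ≤ C * (1 + r) ^ (-(ν + 1 / 2)) := by
  have hν' : -1 < ν := by linarith
  have hs : 0 ≤ ν + 1 / 2 := by linarith
  have hcont : Continuous fun r : ℝ => besselClifford ν (r ^ 2 / 4) :=
    (continuous_besselClifford hν').comp (by fun_prop)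
  obtain ⟨C₀, hC₀⟩ := isCompact_Icc.exists_bound_of_continuousOn (s := Icc (0 : ℝ) 1)
    hcont.continuousOn
  -- The energy at r = 1, which controls the solution on [1, ∞); on [0, 1] compactness suffices.
  set M := ((1 : ℝ) ^ (ν + 1 / 2) * besselClifford ν (1 ^ 2 / 4)) ^ 2 +
    ((ν + 1 / 2) * 1 ^ (ν - 1 / 2) * besselClifford ν (1 ^ 2 / 4) -
        1 ^ (ν + 3 / 2) / 2 * besselClifford (ν + 1) (1 ^ 2 / 4)) ^ 2 with hM
  set E := M * Real.exp (|ν ^ 2 - 1 / 4| / 1) with hE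
  have hEnn : 0 ≤ E := by positivity
  have hC₀nn : 0 ≤ C₀ := (norm_nonneg _).trans (hC₀ 0 (by simp))
  have h2 : (0 : ℝ) < 2 ^ (ν + 1 / 2) := by positivity
  refine ⟨(C₀ + √E + 1) * 2 ^ (ν + 1 / 2), by positivity, fun r hr => ?_⟩
  have key : ∀ B t : ℝ, 0 ≤ B → 0 < t → 1 + r ≤ 2 * t →
      B * t ^ (-(ν + 1 / 2)) ≤ B * 2 ^ (ν + 1 / 2) * (1 + r) ^ (-(ν + 1 / 2)) := by
    intro B t hB ht hrt
    have h3 : (1 + r) ^ (ν + 1 / 2) ≤ 2 ^ (ν + 1 / 2) * t ^ (ν + 1 / 2) := by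
      rw [← Real.mul_rpow two_pos.le ht.le]
      exact Real.rpow_le_rpow (by positivity) hrt hs
    have ht' : 0 < t ^ (ν + 1 / 2) := by positivity
    have hr' : 0 < (1 + r) ^ (ν + 1 / 2) := by positivity
    rw [Real.rpow_neg ht.le, Real.rpow_neg (by positivity), mul_assoc]
    refine mul_le_mul_of_nonneg_left ?_ hB
    rw [← div_eq_mul_inv, le_div_iff₀ hr', inv_mul_le_iff₀ ht']
    linarith
  have hfin : ∀ B, B ≤ C₀ + √E + 1 → B * 2 ^ (ν + 1 / 2) * (1 + r) ^ (-(ν + 1 / 2)) ≤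
      (C₀ + √E + 1) * 2 ^ (ν + 1 / 2) * (1 + r) ^ (-(ν + 1 / 2)) := by
    intro B hB
    gcongr
  rcases le_total r 1 with h1 | h1
  · have h4 := key C₀ 1 hC₀nn one_pos (by linarith)
    rw [Real.one_rpow, mul_one] at h4
    have hE' := Real.sqrt_nonneg E
    exact ((hC₀ r ⟨hr, h1⟩).trans h4).trans (hfin C₀ (by linarith))
  · have hr0 : 0 < r := by linarith
    have h5 := (energy_le_and_ge (fun r hr => hasDerivAt_rpow_mul_besselClifford hν' hr)
      (fun r hr => hasDerivAt_deriv_rpow_mul_besselClifford hν' hr) one_pos h1).1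
    have h6 : (r ^ (ν + 1 / 2) * besselClifford ν (r ^ 2 / 4)) ^ 2 ≤ E :=
      le_trans (le_add_of_nonneg_right (sq_nonneg _)) h5
    have h7 := Real.abs_le_sqrt h6
    have hrp : 0 < r ^ (ν + 1 / 2) := by positivity
    rw [abs_mul, abs_of_pos hrp] at h7
    refine le_trans ?_ ((key √E r (by positivity) hr0 (by linarith)).trans
      (hfin _ (by linarith)))
    rw [Real.rpow_neg hr, ← div_eq_mul_inv, le_div_iff₀ hrp]
    linarith

/-! ### Lower bounds -/

/-- The integral is continuous and positive in r, so it is bounded below on compact intervals. For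
large r, scaling by s = rτ gives r^{-(2μ+2)} times a primitive of the squared Bessel solution, which
grows linearly. -/
theorem exists_le_integral_besselClifford_sq {μ : ℝ} (hμ : -1 / 2 < μ) :
    ∃ c : ℝ, 0 < c ∧ ∀ r : ℝ, 0 < r → c * min 1 (r ^ (-(2 * μ + 1))) ≤
      ∫ τ in (0 : ℝ)..1, besselClifford μ (r ^ 2 / 4 * τ ^ 2) ^ 2 * τ ^ (2 * μ + 1) := by
  have hμ' : -1 < μ := by linarith
  have hexp : 0 < 2 * μ + 1 := by linarith
  have hc := continuous_besselClifford hμ'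
  have hpow : Continuous fun τ : ℝ => τ ^ (2 * μ + 1) :=
    Real.continuous_rpow_const hexp.le
  obtain ⟨δ, hδ, hne⟩ := exists_pos_besselClifford_ne_zero hμ'
  set I : ℝ → ℝ := fun r =>
    ∫ τ in (0 : ℝ)..1, besselClifford μ (r ^ 2 / 4 * τ ^ 2) ^ 2 * τ ^ (2 * μ + 1) with hI
  have hIcont : Continuous I := by
    refine intervalIntegral.continuous_parametric_intervalIntegral_of_continuous' ?_ 0 1
    simp only [Function.uncurry_def]
    exact ((hc.comp (by fun_prop)).pow 2).mul (hpow.comp continuous_snd)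
  have hIpos : ∀ r, 0 < I r := by
    intro r
    have hf : Continuous fun τ : ℝ =>
        besselClifford μ (r ^ 2 / 4 * τ ^ 2) ^ 2 * τ ^ (2 * μ + 1) :=
      ((hc.comp (by fun_prop)).pow 2).mul hpow
    refine intervalIntegral.integral_pos one_pos hf.continuousOn
      (fun τ hτ => mul_nonneg (sq_nonneg _) (Real.rpow_nonneg hτ.1.le _)) ?_
    have hpos : 0 < δ / (r ^ 2 + 1) := by positivity
    -- A point so close to 0 that the argument stays in the zero-free neighbourhood of the origin.
    refine ⟨min 1 (δ / (r ^ 2 + 1)), ⟨by positivity, min_le_left _ _⟩, ?_⟩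
    set τ := min 1 (δ / (r ^ 2 + 1)) with hτ
    have hτ0 : 0 < τ := by positivity
    have hτ1 : τ ≤ 1 := min_le_left _ _
    have hτ2 : τ * (r ^ 2 + 1) ≤ δ := (le_div_iff₀ (by positivity)).1 (min_le_right _ _)
    have hx : |r ^ 2 / 4 * τ ^ 2| ≤ δ := by
      rw [abs_of_nonneg (by positivity)]
      have : r ^ 2 / 4 * τ ^ 2 ≤ r ^ 2 * τ := by
        have h1 : τ ^ 2 ≤ τ := by nlinarith
        nlinarith [mul_le_mul_of_nonneg_left h1 (sq_nonneg r), mul_nonneg (sq_nonneg r) hτ0.le]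
      nlinarith
    have := hne _ hx
    positivity
  set Y : ℝ → ℝ := fun r => ∫ s in (0 : ℝ)..r, besselClifford μ (s ^ 2 / 4) ^ 2 * s ^ (2 * μ + 1)
    with hYdef
  have hYcont : Continuous fun s : ℝ => besselClifford μ (s ^ 2 / 4) ^ 2 * s ^ (2 * μ + 1) :=
    ((hc.comp (by fun_prop)).pow 2).mul hpow
  have hYderiv : ∀ r, 0 < r →
      HasDerivAt Y ((r ^ (μ + 1 / 2) * besselClifford μ (r ^ 2 / 4)) ^ 2) r := by
    intro r hr
    have h := intervalIntegral.integral_hasDerivAt_right (hYcont.intervalIntegrable 0 r)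
      (hYcont.stronglyMeasurableAtFilter _ _) hYcont.continuousAt
    convert! h using 1
    rw [mul_pow, ← Real.rpow_natCast (r ^ _), ← Real.rpow_mul hr.le,
      show (μ + 1 / 2) * ((2 : ℕ) : ℝ) = 2 * μ + 1 by push_cast; ring]
    ring
  have hYI : ∀ r, 0 < r → Y r = r ^ (2 * μ + 2) * I r := by
    intro r hr
    have h := intervalIntegral.integral_comp_mul_left (a := 0) (b := 1)
      (fun s : ℝ => besselClifford μ (s ^ 2 / 4) ^ 2 * s ^ (2 * μ + 1)) hr.ne'
    rw [mul_zero, mul_one, smul_eq_mul, eq_inv_mul_iff_mul_eq₀ hr.ne'] at h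
    rw [hYdef]
    simp only
    rw [← h, hI]
    simp only
    rw [← intervalIntegral.integral_const_mul, ← intervalIntegral.integral_const_mul]
    refine intervalIntegral.integral_congr fun τ hτ => ?_
    have hτ0 : 0 ≤ τ := by simpa using (uIcc_of_le (zero_le_one' ℝ) ▸ hτ).1
    rw [Real.mul_rpow hr.le hτ0, show 2 * μ + 2 = 2 * μ + 1 + 1 by ring,
      Real.rpow_add_one hr.ne' (2 * μ + 1),
      show (r * τ) ^ 2 / 4 = r ^ 2 / 4 * τ ^ 2 by ring]
    ring
  obtain ⟨a, ha, hapos⟩ : ∃ a : ℝ, 0 < a ∧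
      0 < (a ^ (μ + 1 / 2) * besselClifford μ (a ^ 2 / 4)) ^ 2 +
        ((μ + 1 / 2) * a ^ (μ - 1 / 2) * besselClifford μ (a ^ 2 / 4) -
        a ^ (μ + 3 / 2) / 2 * besselClifford (μ + 1) (a ^ 2 / 4)) ^ 2 := by
    -- At r = √δ the argument r²/4 lies within the zero-free range, so the energy there is positive.
    refine ⟨√δ, by positivity, ?_⟩
    have := hne (√δ ^ 2 / 4) (by
      rw [Real.sq_sqrt hδ.le, abs_of_nonneg (by positivity)]; linarith)
    have h3 : 0 < √δ ^ (μ + 1 / 2) := by positivity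
    positivity
  obtain ⟨c₁, r₁, hc₁, hr₁, hlin⟩ := exists_linear_le_primitive_sq
    (fun r hr => hasDerivAt_rpow_mul_besselClifford hμ' hr)
    (fun r hr => hasDerivAt_deriv_rpow_mul_besselClifford hμ' hr) hYderiv ha hapos
  obtain ⟨s, -, hs⟩ := isCompact_Icc.exists_isMinOn (s := Icc (0 : ℝ) r₁)
    ⟨0, by simp [hr₁.le]⟩ hIcont.continuousOn
  refine ⟨min (I s) c₁, lt_min (hIpos s) hc₁, fun r hr => ?_⟩
  have hmin : 0 < min (I s) c₁ := lt_min (hIpos s) hc₁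
  rcases le_total r r₁ with h | h
  · refine le_trans ?_ (hs ⟨hr.le, h⟩)
    exact (mul_le_of_le_one_right hmin.le (min_le_left _ _)).trans (min_le_left _ _)
  · have h1 := hlin r h
    rw [hYI r hr, show 2 * μ + 2 = (2 * μ + 1) + 1 by ring, Real.rpow_add_one hr.ne'] at h1
    have h2 : c₁ ≤ r ^ (2 * μ + 1) * I r := by
      refine le_of_mul_le_mul_right ?_ hr
      linarith
    have hrp : 0 < r ^ (2 * μ + 1) := by positivity
    calc min (I s) c₁ * min 1 (r ^ (-(2 * μ + 1))) ≤ c₁ * r ^ (-(2 * μ + 1)) := by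
          gcongr
          · exact min_le_right _ _
          · exact min_le_right _ _
      _ ≤ I r := by
          rw [Real.rpow_neg hr.le, ← div_eq_mul_inv, div_le_iff₀ hrp]
          linarith

theorem integrableOn_continuous_mul_betaIntegrand_sq {f : ℝ → ℝ} (hf : Continuous f) {a q : ℝ}
    (ha : 0 < a) (hq : 0 < q) :
    IntegrableOn (fun τ : ℝ => f τ * (τ ^ (2 * a - 1) * (1 - τ ^ 2) ^ (q - 1))) (Ioo 0 1) := by
  obtain ⟨C, hC⟩ := isCompact_Icc.exists_bound_of_continuousOn (s := Icc (0 : ℝ) 1)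
    hf.continuousOn
  refine Integrable.bdd_mul (c := C) (integrableOn_betaIntegrand_sq ha hq)
    hf.aestronglyMeasurable ?_
  filter_upwards [ae_restrict_mem measurableSet_Ioo] with τ hτ using hC τ ⟨hτ.1.le, hτ.2.le⟩

/-- The borderline order 2p - 1 equals 2μ with μ = p - 1/2, so the integral is one of a square; the
weight (1-τ²)^{-1/2} ≥ 1 can be dropped. -/
theorem exists_le_integral_besselClifford_of_eq {p : ℝ} (hp : 1 / 2 ≤ p) :
    ∃ c : ℝ, 0 < c ∧ ∀ r : ℝ, 0 < r → c * min 1 (r ^ (-(2 * p))) ≤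
      ∫ τ in Ioo (0 : ℝ) 1, besselClifford (2 * p - 1) (r ^ 2 / 4 * τ ^ 2) * τ ^ (2 * p - 1) := by
  set μ := p - 1 / 2 with hμdef
  have hμ : -1 / 2 < μ := by linarith
  have h4 : (0 : ℝ) < 4 ^ μ := by positivity
  obtain ⟨c, hc, h⟩ := exists_le_integral_besselClifford_sq hμ
  refine ⟨c / 4 ^ μ, by positivity, fun r hr => ?_⟩
  -- The identity doubles the frequency, hence r/2.
  have h1 := integral_besselClifford_sq hμ ((r / 2) ^ 2 / 4)
  have h2 := h (r / 2) (by positivity)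
  rw [show 4 * ((r / 2) ^ 2 / 4) = r ^ 2 / 4 by ring, show 2 * μ = 2 * p - 1 by
    rw [hμdef]; ring] at h1
  rw [show 2 * μ + 1 = 2 * p by rw [hμdef]; ring] at h2
  rw [show 2 * p - 1 + 1 = 2 * p by ring] at h1
  have h3 : ∫ τ in (0 : ℝ)..1, besselClifford μ ((r / 2) ^ 2 / 4 * τ ^ 2) ^ 2 * τ ^ (2 * p) ≤
      ∫ τ in Ioo (0 : ℝ) 1, besselClifford μ ((r / 2) ^ 2 / 4 * τ ^ 2) ^ 2 *
        (τ ^ (2 * p) * (1 - τ ^ 2) ^ (-1 / 2 : ℝ)) := by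
    have hcont : Continuous fun τ : ℝ => besselClifford μ ((r / 2) ^ 2 / 4 * τ ^ 2) ^ 2 :=
      ((continuous_besselClifford (by linarith)).comp (by fun_prop)).pow 2
    have hi1 := integrableOn_continuous_mul_betaIntegrand_sq hcont (a := p + 1 / 2) (q := 1 / 2)
      (by linarith) (by norm_num)
    have hi2 := integrableOn_continuous_mul_betaIntegrand_sq hcont (a := p + 1 / 2) (q := 1)
      (by linarith) (by norm_num)
    rw [show 2 * (p + 1 / 2) - 1 = 2 * p by ring, show (1 / 2 - 1 : ℝ) = -1 / 2 by norm_num] at hi1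
    simp only [show 2 * (p + 1 / 2) - 1 = 2 * p by ring, sub_self, Real.rpow_zero, mul_one] at hi2
    rw [intervalIntegral.integral_of_le zero_le_one, integral_Ioc_eq_integral_Ioo]
    refine setIntegral_mono_on hi2 hi1 measurableSet_Ioo fun τ hτ => ?_
    have h5 : 0 < 1 - τ ^ 2 := by nlinarith [hτ.1, hτ.2]
    have h6 : 1 ≤ (1 - τ ^ 2) ^ (-1 / 2 : ℝ) :=
      Real.one_le_rpow_of_pos_of_le_one_of_nonpos h5 (by nlinarith [sq_nonneg τ]) (by norm_num)
    have h7 : 0 ≤ τ ^ (2 * p) := Real.rpow_nonneg hτ.1.le _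
    exact mul_le_mul_of_nonneg_left (le_mul_of_one_le_right h7 h6) (sq_nonneg _)
  rw [div_mul_eq_mul_div, div_le_iff₀ h4, mul_comm (∫ τ in Ioo (0 : ℝ) 1, _), ← h1]
  refine le_trans ?_ (h2.trans h3)
  gcongr c * min 1 ?_
  exact Real.rpow_le_rpow_of_nonpos (by positivity) (by linarith) (by linarith)

theorem hasSum_integral_besselClifford_mul_rpow {ν p : ℝ} (hν : -1 < ν) (hp : 0 < p) (x : ℝ) :
    HasSum (fun k : ℕ => (-1) ^ k / (k.factorial * Real.Gamma (ν + k + 1)) * x ^ k *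
        (1 / (2 * (p + k))))
      (∫ τ in Ioo (0 : ℝ) 1, besselClifford ν (x * τ ^ 2) * τ ^ (2 * p - 1)) := by
  have h := hasSum_integral_tsum_betaIntegrand (besselClifford_summable_abs hν x)
    hp (one_pos : (0 : ℝ) < 1)
  simp only [sub_self, Real.rpow_zero, mul_one] at h
  simp only [besselClifford, mul_pow x, ← mul_assoc _ (x ^ _)]
  convert! h using 2 with k
  have hpk : 0 < p + k := by positivity
  have hG : Real.Gamma (p + k) ≠ 0 := (Real.Gamma_pos_of_pos hpk).ne'
  rw [beta, Real.Gamma_add_one hpk.ne', Real.Gamma_one]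
  field_simp

/-- Sonine's integral, integrated once more in τ. Comparing coefficients in x avoids exchanging the
two integrals. -/
theorem integral_integral_besselClifford_sonine {μ ν p : ℝ} (hμ : -1 < μ) (hμν : μ < ν)
    (hp : 0 < p) (x : ℝ) :
    ∫ t in Ioo (0 : ℝ) 1,
      (∫ τ in Ioo (0 : ℝ) 1, besselClifford μ (x * t ^ 2 * τ ^ 2) * τ ^ (2 * p - 1)) *
        (t ^ (2 * μ + 1) * (1 - t ^ 2) ^ (ν - μ - 1)) =
      Real.Gamma (ν - μ) / 2 *
        ∫ τ in Ioo (0 : ℝ) 1, besselClifford ν (x * τ ^ 2) * τ ^ (2 * p - 1) := by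
  have hsum : Summable fun k : ℕ => |(-1) ^ k / (k.factorial * Real.Gamma (μ + k + 1)) * x ^ k *
        (1 / (2 * (p + k)))| := by
    refine Summable.of_nonneg_of_le (fun _ => abs_nonneg _) (fun k => ?_)
      ((besselClifford_summable_abs hμ x).mul_right (1 / (2 * p)))
    rw [abs_mul, abs_of_nonneg (a := 1 / (2 * (p + k))) (by positivity)]
    gcongr
    simp
  have h1 := hasSum_integral_tsum_betaIntegrand hsum (a := μ + 1) (q := ν - μ) (by linarith)
    (by linarith)
  have h2 := (hasSum_integral_besselClifford_mul_rpow (ν := ν) (by linarith) hp x).mul_left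
    (Real.Gamma (ν - μ) / 2)
  have h3 : ∀ t : ℝ, ∫ τ in Ioo (0 : ℝ) 1, besselClifford μ (x * t ^ 2 * τ ^ 2) * τ ^ (2 * p - 1)
      = ∑' k : ℕ, (-1) ^ k / (k.factorial * Real.Gamma (μ + k + 1)) * x ^ k *
        (1 / (2 * (p + k))) * (t ^ 2) ^ k := fun t => by
    rw [← (hasSum_integral_besselClifford_mul_rpow hμ hp (x * t ^ 2)).tsum_eq]
    refine tsum_congr fun k => ?_
    rw [mul_pow x]
    ring
  rw [show 2 * (μ + 1) - 1 = 2 * μ + 1 by ring] at h1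
  simp only [h3]
  refine h1.unique ?_
  convert! h2 using 2 with k
  have h4 := (Gamma_add_nat_pos hμ k).ne'
  have h5 := (Gamma_add_nat_pos (ν := ν) (by linarith) k).ne'
  have hpk : p + k ≠ 0 := by positivity
  rw [beta, show μ + 1 + k = μ + k + 1 by ring, show μ + k + 1 + (ν - μ) = ν + k + 1 by ring]
  field_simp

/-- A higher order is an average of the borderline one over smaller radii rt with a nonnegative
weight, and t < 1 only increases the lower bound. -/
theorem exists_le_integral_besselClifford {p ν : ℝ} (hp : 1 / 2 ≤ p) (hν : 2 * p - 1 ≤ ν) :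
    ∃ c : ℝ, 0 < c ∧ ∀ r : ℝ, 0 < r → c * min 1 (r ^ (-(2 * p))) ≤
      ∫ τ in Ioo (0 : ℝ) 1, besselClifford ν (r ^ 2 / 4 * τ ^ 2) * τ ^ (2 * p - 1) := by
  obtain ⟨c, hc, h⟩ := exists_le_integral_besselClifford_of_eq hp
  rcases hν.eq_or_lt with rfl | hν
  · exact ⟨c, hc, h⟩
  set μ := 2 * p - 1 with hμ
  have hμ' : -1 < μ := by linarith
  have hG : 0 < Real.Gamma (ν - μ) := Real.Gamma_pos_of_pos (by linarith)
  set J := beta (μ + 1) (ν - μ) / 2 with hJ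
  have hJpos : 0 < J := half_pos (beta_pos (by linarith) (by linarith))
  refine ⟨c * J / (Real.Gamma (ν - μ) / 2), by positivity, fun r hr => ?_⟩
  rw [div_mul_eq_mul_div, div_le_iff₀ (by positivity), mul_comm (∫ τ in Ioo (0 : ℝ) 1, _),
    ← integral_integral_besselClifford_sonine hμ' hν (by linarith)]
  have hJ' := integral_betaIntegrand_sq (a := μ + 1) (q := ν - μ) (by linarith) (by linarith)
  have hint := integrableOn_betaIntegrand_sq (a := μ + 1) (q := ν - μ) (by linarith) (by linarith)
  rw [show 2 * (μ + 1) - 1 = 2 * μ + 1 by ring] at hJ' hint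
  rw [hJ, mul_right_comm, ← hJ', ← integral_const_mul]
  refine setIntegral_mono_on (hint.const_mul _) ?_ measurableSet_Ioo fun t ht => ?_
  · have hcont : Continuous fun t : ℝ => ∫ τ in Ioo (0 : ℝ) 1,
        besselClifford μ (r ^ 2 / 4 * t ^ 2 * τ ^ 2) * τ ^ (2 * p - 1) := by
      simp only [← integral_Ioc_eq_integral_Ioo, ← intervalIntegral.integral_of_le zero_le_one]
      refine intervalIntegral.continuous_parametric_intervalIntegral_of_continuous' ?_ 0 1
      simp only [Function.uncurry_def]
      exact ((continuous_besselClifford hμ').comp (by fun_prop)).mul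
        ((Real.continuous_rpow_const (by linarith)).comp continuous_snd)
    have := integrableOn_continuous_mul_betaIntegrand_sq hcont (a := μ + 1) (q := ν - μ)
      (by linarith) (by linarith)
    rwa [show 2 * (μ + 1) - 1 = 2 * μ + 1 by ring] at this
  · have h1 : 0 ≤ 1 - t ^ 2 := by nlinarith [ht.1, ht.2]
    have h2 : 0 ≤ t := ht.1.le
    refine mul_le_mul_of_nonneg_right ?_ (by positivity)
    have h3 := h (r * t) (mul_pos hr ht.1)
    rw [show (r * t) ^ 2 / 4 = r ^ 2 / 4 * t ^ 2 by ring] at h3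
    refine le_trans ?_ h3
    gcongr c * min 1 ?_
    refine Real.rpow_le_rpow_of_nonpos (mul_pos hr ht.1) ?_ (by linarith)
    nlinarith [ht.2]

/-! ### The Bochner–Riesz multiplier and its Fourier transform -/

theorem truncPow_nonneg (α t : ℝ) : 0 ≤ truncPow α t := by
  unfold truncPow
  split_ifs with h
  · positivity
  · exact le_rfl

theorem truncPow_mul {α c t : ℝ} (hc : 0 < c) : truncPow α (c * t) = c ^ α * truncPow α t := by
  unfold truncPow
  by_cases h : 0 < t
  · rw [if_pos (mul_pos hc h), if_pos h, Real.mul_rpow hc.le h.le]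
  · rw [if_neg h, if_neg (fun h' => h (pos_of_mul_pos_right h' hc.le)), mul_zero]

theorem bochnerRiesz_eq_smul {d : ℕ} (α : ℝ) {Ω : ℝ} (hΩ : 0 < Ω)
    (ξ : EuclideanSpace ℝ (Fin d)) :
    bochnerRiesz α Ω ξ = bochnerRiesz α 1 (Ω⁻¹ • ξ) := by
  unfold bochnerRiesz
  rw [norm_smul, Real.norm_of_nonneg (by positivity)]
  congr 2
  field_simp

/-- Polar coordinates reduce this to a beta integral with parameters d/2 and α + 1. -/
theorem integrable_bochnerRiesz {d : ℕ} (hd : 1 ≤ d) {α : ℝ} (hα : -1 < α) {Ω : ℝ}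
    (hΩ : 0 < Ω) : Integrable (bochnerRiesz (d := d) α Ω) := by
  have h1 : Integrable (bochnerRiesz (d := d) α 1) := by
    have : Nonempty (Fin d) := ⟨⟨0, hd⟩⟩
    have hd' : (0 : ℝ) < d := by exact_mod_cast hd
    refine (integrable_fun_norm_addHaar (E := EuclideanSpace ℝ (Fin d)) volume
      (f := fun y => truncPow α (1 - y ^ 2 / 1 ^ 2))).2 ?_
    have h := integrableOn_betaIntegrand_sq (a := (d : ℝ) / 2) (q := α + 1) (by positivity)
      (by linarith)
    rw [← integrable_indicator_iff measurableSet_Ioo] at h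
    refine h.integrableOn.congr_fun (fun y hy => ?_) measurableSet_Ioi
    have hy0 : 0 < y := hy
    simp only [finrank_euclideanSpace, Fintype.card_fin, truncPow, smul_eq_mul, one_pow, div_one]
    by_cases hy1 : y < 1
    · rw [indicator_of_mem (show y ∈ Ioo (0 : ℝ) 1 from ⟨hy0, hy1⟩), if_pos (by nlinarith),
        ← Real.rpow_natCast y (d - 1), Nat.cast_sub hd]
      congr 2 <;> push_cast <;> ring
    · rw [indicator_of_notMem (fun h' => hy1 h'.2), if_neg (by nlinarith), mul_zero]
  rw [show bochnerRiesz (d := d) α Ω = fun ξ => bochnerRiesz α 1 (Ω⁻¹ • ξ) from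
    funext fun ξ => bochnerRiesz_eq_smul α hΩ ξ]
  exact h1.comp_smul (inv_ne_zero hΩ.ne')

/-- Rescaling by √u: homogeneity contributes u^α and the Jacobian u^{n/2}. Integrating out n
variables thus raises the exponent by n/2. -/
theorem integral_truncPow_slice {n : ℕ} (α : ℝ) (u : ℝ) :
    ∫ η : Fin n → ℝ, truncPow α (u - ∑ i, η i ^ 2) =
      truncPow (α + n / 2) u * ∫ η : Fin n → ℝ, truncPow α (1 - ∑ i, η i ^ 2) := by
  by_cases hu : 0 < u
  · have h := Measure.integral_comp_smul (volume : Measure (Fin n → ℝ))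
      (fun η : Fin n → ℝ => truncPow α (u - ∑ i, η i ^ 2)) √u
    have h2 : ∀ η : Fin n → ℝ, truncPow α (u - ∑ i, (√u • η) i ^ 2) =
        u ^ α * truncPow α (1 - ∑ i, η i ^ 2) := by
      intro η
      rw [← truncPow_mul hu, mul_sub, mul_one, Finset.mul_sum]
      simp [mul_pow, Real.sq_sqrt hu.le]
    simp only [h2] at h
    have hs : 0 < √u ^ n := by positivity
    rw [integral_const_mul, Module.finrank_fin_fun, abs_of_pos (by positivity), smul_eq_mul,
      eq_inv_mul_iff_mul_eq₀ hs.ne'] at h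
    rw [← h, truncPow, if_pos hu, Real.rpow_add hu, Real.sqrt_eq_rpow, ← Real.rpow_natCast,
      ← Real.rpow_mul hu.le, show (1 / 2 * n : ℝ) = n / 2 by ring]
    ring
  · have h2 : ∀ η : Fin n → ℝ, truncPow α (u - ∑ i, η i ^ 2) = 0 := by
      intro η
      have : 0 ≤ ∑ i, η i ^ 2 := Finset.sum_nonneg fun i _ => sq_nonneg _
      exact if_neg (by linarith)
    rw [show truncPow (α + n / 2) u = 0 from if_neg hu, zero_mul]
    simp only [h2, integral_zero]

/-- The isomorphism `ℝ × ℝⁿ ≃ ℝⁿ⁺¹`. -/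
noncomputable def euclideanSpaceConsEquiv (n : ℕ) :
    ℝ × (Fin n → ℝ) ≃ᵐ EuclideanSpace ℝ (Fin (n + 1)) :=
  (MeasurableEquiv.piFinSuccAbove (fun _ => ℝ) 0).symm.trans
    (MeasurableEquiv.toLp 2 (Fin (n + 1) → ℝ))

theorem measurePreserving_euclideanSpaceConsEquiv (n : ℕ) :
    MeasurePreserving (euclideanSpaceConsEquiv n) :=
  (volume_preserving_piFinSuccAbove (fun _ => ℝ) 0).symm.trans
    (PiLp.volume_preserving_toLp (Fin (n + 1)))

theorem euclideanSpaceConsEquiv_zero {n : ℕ} (p : ℝ × (Fin n → ℝ)) :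
    euclideanSpaceConsEquiv n p 0 = p.1 := by
  simp [euclideanSpaceConsEquiv, MeasurableEquiv.piFinSuccAbove]

theorem norm_sq_euclideanSpaceConsEquiv {n : ℕ} (p : ℝ × (Fin n → ℝ)) :
    ‖euclideanSpaceConsEquiv n p‖ ^ 2 = p.1 ^ 2 + ∑ i, p.2 i ^ 2 := by
  rw [EuclideanSpace.norm_sq_eq, Fin.sum_univ_succ]
  simp [euclideanSpaceConsEquiv, MeasurableEquiv.piFinSuccAbove]

theorem integral_eq_integral_cos {w : ℝ → ℝ} (hw : ∀ s, w (-s) = w s) (c : ℝ)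
    (hint : Integrable fun s : ℝ => Complex.exp (c * s * Complex.I) * (w s : ℂ)) :
    ∫ s : ℝ, Complex.exp (c * s * Complex.I) * (w s : ℂ) =
      ((2 * ∫ s in Ioi (0 : ℝ), Real.cos (c * s) * w s : ℝ) : ℂ) := by
  set g : ℝ → ℂ := fun s => Complex.exp (c * s * Complex.I) * (w s : ℂ) with hg
  have h1 : ∫ s, g (-s) = ∫ s, g s := integral_neg_eq_self g volume
  have h2 : ∫ s, (g s + g (-s)) = 2 * ∫ s, g s := by
    rw [integral_add hint hint.comp_neg, h1, two_mul]
  have h3 : ∀ s, g s + g (-s) = ((2 * (Real.cos (c * |s|) * w |s|) : ℝ) : ℂ) := by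
    intro s
    have h4 : w |s| = w s := by
      rcases abs_choice s with h | h <;> rw [h]
      exact hw s
    have h5 : Real.cos (c * |s|) = Real.cos (c * s) := by
      rcases abs_choice s with h | h <;> rw [h]
      rw [mul_neg, Real.cos_neg]
    rw [h4, h5, hg]
    simp only [hw]
    push_cast
    rw [← add_mul, ← mul_assoc, Complex.two_cos]
    ring_nf
  simp only [h3] at h2
  rw [integral_complex_ofReal, integral_const_mul,
    integral_comp_abs (f := fun u => Real.cos (c * u) * w u)] at h2
  have : (2 : ℂ) ≠ 0 := two_ne_zero
  refine mul_left_cancel₀ this (h2.symm.trans ?_)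
  push_cast
  ring

/-- The reflection exchanging two vectors of equal norm preserves the radial multiplier. -/
theorem fourier_bochnerRiesz_one_eq_rotate {d : ℕ} (α : ℝ) {v w : EuclideanSpace ℝ (Fin d)}
    (h : ‖v‖ = ‖w‖) : 𝓕 (fun ξ : EuclideanSpace ℝ (Fin d) => (bochnerRiesz α 1 ξ : ℂ)) v =
      𝓕 (fun ξ : EuclideanSpace ℝ (Fin d) => (bochnerRiesz α 1 ξ : ℂ)) w := by
  set A := (ℝ ∙ (v - w))ᗮ.reflection with hA
  have hAv : A v = w := Submodule.reflection_sub h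
  have hf : (fun ξ : EuclideanSpace ℝ (Fin d) => (bochnerRiesz α 1 ξ : ℂ)) ∘ A =
      fun ξ => (bochnerRiesz α 1 ξ : ℂ) := by
    funext ξ
    simp [bochnerRiesz, A.norm_map]
  rw [← hAv, ← Real.fourier_comp_linearIsometry, hf]

/-- After rotating t to the first axis, the other variables integrate out by slices, leaving the
cosine transform of (1-s²)^{α+n/2}: Poisson's integral of order ν, as α + n/2 = ν - 1/2. -/
theorem exists_fourier_bochnerRiesz_one {n : ℕ} {α : ℝ} (hα : -1 < α) :
    ∃ A : ℝ, ∀ t : EuclideanSpace ℝ (Fin (n + 1)),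
      𝓕 (fun ξ : EuclideanSpace ℝ (Fin (n + 1)) => (bochnerRiesz α 1 ξ : ℂ)) t =
      ((A * besselClifford (α + (n + 1 : ℕ) / 2) ((2 * Real.pi * ‖t‖) ^ 2 / 4) : ℝ) : ℂ) := by
  set ν := α + (n + 1 : ℕ) / 2 with hν
  have hν' : -1 / 2 < ν := by
    rw [hν]; push_cast; have : (0 : ℝ) ≤ n := n.cast_nonneg; linarith
  set B := ∫ η : Fin n → ℝ, truncPow α (1 - ∑ i, η i ^ 2) with hB
  refine ⟨2 * B * (√Real.pi * Real.Gamma (ν + 1 / 2) / 2), fun t => ?_⟩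
  have hnorm : ‖t‖ = ‖EuclideanSpace.single (0 : Fin (n + 1)) ‖t‖‖ := by simp
  have hint := (Real.fourierIntegral_convergent_iff (μ := volume)
    (f := fun ξ : EuclideanSpace ℝ (Fin (n + 1)) => (bochnerRiesz α 1 ξ : ℂ))
    (EuclideanSpace.single (0 : Fin (n + 1)) ‖t‖)).2
    (integrable_bochnerRiesz (d := n + 1) (by omega) hα one_pos).ofReal
  rw [fourier_bochnerRiesz_one_eq_rotate α hnorm, Real.fourier_eq,
    ← (measurePreserving_euclideanSpaceConsEquiv n).integral_comp
      (euclideanSpaceConsEquiv n).measurableEmbedding]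
  rw [← (measurePreserving_euclideanSpaceConsEquiv n).integrable_comp_emb
      (euclideanSpaceConsEquiv n).measurableEmbedding] at hint
  have heq : ∀ p : ℝ × (Fin n → ℝ), (Real.fourierChar (-inner ℝ (euclideanSpaceConsEquiv n p)
      (EuclideanSpace.single (0 : Fin (n + 1)) ‖t‖))) •
        (bochnerRiesz α 1 (euclideanSpaceConsEquiv n p) : ℂ) =
      Complex.exp ((-(2 * Real.pi * ‖t‖) : ℝ) * p.1 * Complex.I) *
        (truncPow α (1 - p.1 ^ 2 - ∑ i, p.2 i ^ 2) : ℂ) := by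
    intro p
    rw [Circle.smul_def, Real.fourierChar_apply, smul_eq_mul, bochnerRiesz,
      norm_sq_euclideanSpaceConsEquiv, EuclideanSpace.inner_single_right,
      euclideanSpaceConsEquiv_zero]
    congr 2
    · simp; ring
    · rw [one_pow, div_one, sub_sub]
  simp only [Function.comp_def, heq] at hint ⊢
  have hint1 := hint.integral_prod_left
  rw [Measure.volume_eq_prod, integral_prod _ hint]
  simp only [integral_const_mul, integral_complex_ofReal, integral_truncPow_slice, ← hB]
    at hint1 ⊢
  rw [integral_eq_integral_cos (w := fun s => truncPow (α + n / 2) (1 - s ^ 2) * B)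
    (fun s => by simp) _ hint1]
  congr 1
  have h2 : ∀ s ∈ Ioi (0 : ℝ), Real.cos (-(2 * Real.pi * ‖t‖) * s) *
      (truncPow (α + n / 2) (1 - s ^ 2) * B) = (Ioo (0 : ℝ) 1).indicator (fun s =>
        (Real.cos (2 * Real.pi * ‖t‖ * s) * (1 - s ^ 2) ^ (ν - 1 / 2)) * B) s := by
    intro s hs
    have hs0 : 0 < s := hs
    by_cases hs1 : s < 1
    · rw [indicator_of_mem (show s ∈ Ioo (0 : ℝ) 1 from ⟨hs0, hs1⟩), truncPow, if_pos (by nlinarith), neg_mul, Real.cos_neg,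
        show ν - 1 / 2 = α + n / 2 by rw [hν]; push_cast; ring]
      ring
    · rw [indicator_of_notMem (fun h' => hs1 h'.2), truncPow, if_neg (by nlinarith)]
      ring
  rw [setIntegral_congr_fun measurableSet_Ioi h2, setIntegral_indicator measurableSet_Ioo,
    inter_eq_self_of_subset_right Ioo_subset_Ioi_self, integral_mul_const,
    integral_cos_mul_one_sub_sq_rpow hν']
  ring

theorem integral_bochnerRiesz_one_pos {d : ℕ} (hd : 1 ≤ d) {α : ℝ} (hα : -1 < α) :
    0 < ∫ ξ : EuclideanSpace ℝ (Fin d), bochnerRiesz α 1 ξ := by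
  rw [integral_pos_iff_support_of_nonneg (f := bochnerRiesz (d := d) α 1)
    (fun ξ => truncPow_nonneg _ _) (integrable_bochnerRiesz hd hα one_pos)]
  refine lt_of_lt_of_le (Metric.measure_ball_pos volume (0 : EuclideanSpace ℝ (Fin d)) one_pos)
    (measure_mono fun ξ hξ => ?_)
  rw [mem_ball_zero_iff] at hξ
  have h : 0 < 1 - ‖ξ‖ ^ 2 / 1 ^ 2 := by nlinarith [norm_nonneg ξ]
  rw [Function.mem_support, bochnerRiesz, truncPow, if_pos h]
  positivity

/-- The Fourier transform of the Bochner–Riesz multiplier is a Bessel function. -/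
theorem exists_fourier_bochnerRiesz {d : ℕ} (hd : 1 ≤ d) {α : ℝ} (hα : -1 < α) :
    ∃ A : ℝ, 0 < A ∧ ∀ Ω : ℝ, 0 < Ω → ∀ t : EuclideanSpace ℝ (Fin d),
      𝓕 (fun ξ : EuclideanSpace ℝ (Fin d) => (bochnerRiesz α Ω ξ : ℂ)) t =
      ((Ω ^ d * (A * besselClifford (α + d / 2) ((2 * Real.pi * Ω * ‖t‖) ^ 2 / 4)) : ℝ) : ℂ) := by
  obtain ⟨n, rfl⟩ : ∃ n, d = n + 1 := ⟨d - 1, by omega⟩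
  obtain ⟨A, hA⟩ := exists_fourier_bochnerRiesz_one (n := n) hα
  refine ⟨A, ?_, fun Ω hΩ t => ?_⟩
  -- Evaluating at t = 0: the positive mass of the multiplier is A/Γ(ν+1), with ν = α + d/2.
  · have h0 := hA 0
    rw [Real.fourier_eq] at h0
    simp only [inner_zero_right, neg_zero, AddChar.map_zero_eq_one, one_smul, norm_zero, mul_zero,
      ne_eq, OfNat.ofNat_ne_zero, not_false_eq_true, zero_pow, zero_div, besselClifford_zero,
      integral_complex_ofReal] at h0
    have h1 := integral_bochnerRiesz_one_pos hd hα
    rw [Complex.ofReal_inj.1 h0] at h1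
    refine pos_of_mul_pos_left h1 (inv_nonneg.2 (Real.Gamma_pos_of_pos ?_).le)
    push_cast
    have : (0 : ℝ) ≤ n := n.cast_nonneg
    linarith
  · have h := Measure.integral_comp_smul
      (volume : Measure (EuclideanSpace ℝ (Fin (n + 1))))
      (fun ξ => Real.fourierChar (-inner ℝ ξ t) • (bochnerRiesz α Ω ξ : ℂ)) Ω
    have h2 : ∀ ξ : EuclideanSpace ℝ (Fin (n + 1)),
        Real.fourierChar (-inner ℝ (Ω • ξ) t) • (bochnerRiesz α Ω (Ω • ξ) : ℂ) =
        Real.fourierChar (-inner ℝ ξ (Ω • t)) • (bochnerRiesz α 1 ξ : ℂ) := by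
      intro ξ
      rw [bochnerRiesz_eq_smul α hΩ, inv_smul_smul₀ hΩ.ne', real_inner_smul_left,
        real_inner_smul_right]
    simp only [h2] at h
    rw [← Real.fourier_eq, ← Real.fourier_eq, hA, finrank_euclideanSpace, Fintype.card_fin,
      abs_of_pos (by positivity), norm_smul, Real.norm_of_nonneg hΩ.le,
      eq_inv_smul_iff₀ (by positivity)] at h
    rw [← h, Complex.real_smul, ← Complex.ofReal_mul, ← mul_assoc (2 * Real.pi)]

/-! ### Radial integrals -/

theorem setIntegral_ball_fun_norm {d : ℕ} (hd : 1 ≤ d) (f : ℝ → ℝ) {r : ℝ} (hr : 0 < r) :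
    ∫ t in Metric.ball (0 : EuclideanSpace ℝ (Fin d)) r, f ‖t‖ =
      d * volume.real (Metric.ball (0 : EuclideanSpace ℝ (Fin d)) 1) *
        (r ^ d * ∫ τ in Ioo (0 : ℝ) 1, f (r * τ) * τ ^ (d - 1)) := by
  have : Nonempty (Fin d) := ⟨⟨0, hd⟩⟩
  have h := integral_fun_norm_addHaar (volume : Measure (EuclideanSpace ℝ (Fin d)))
    ((Iio r).indicator f)
  have h1 : ∀ t : EuclideanSpace ℝ (Fin d), (Iio r).indicator f ‖t‖ =
      (Metric.ball (0 : EuclideanSpace ℝ (Fin d)) r).indicator (fun t => f ‖t‖) t := by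
    intro t
    simp [indicator]
  have h2 : ∀ y : ℝ, y ^ (d - 1) • (Iio r).indicator f y =
      (Iio r).indicator (fun y => y ^ (d - 1) * f y) y := by
    intro y
    by_cases hy : y < r <;> simp [indicator, hy]
  simp only [h1, h2, finrank_euclideanSpace, Fintype.card_fin] at h
  rw [integral_indicator Metric.isOpen_ball.measurableSet, setIntegral_indicator measurableSet_Iio,
    Ioi_inter_Iio, nsmul_eq_mul, smul_eq_mul] at h
  rw [h, ← mul_assoc]
  congr 1
  have h3 := intervalIntegral.integral_comp_mul_left (a := 0) (b := 1)
    (fun y : ℝ => y ^ (d - 1) * f y) hr.ne'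
  rw [mul_zero, mul_one, intervalIntegral.integral_of_le hr.le,
    intervalIntegral.integral_of_le zero_le_one, integral_Ioc_eq_integral_Ioo,
    integral_Ioc_eq_integral_Ioo, smul_eq_mul, eq_inv_mul_iff_mul_eq₀ hr.ne',
    ← integral_const_mul] at h3
  rw [← h3, ← integral_const_mul]
  congr 1
  funext τ
  obtain ⟨n, rfl⟩ : ∃ n, d = n + 1 := ⟨d - 1, by omega⟩
  simp only [Nat.add_sub_cancel]
  ring

theorem one_le_growth (d : ℕ) (α : ℝ) {s : ℝ} (hs : 0 ≤ s) : 1 ≤ growth d α s := by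
  unfold growth
  split_ifs with h1 h2
  · exact Real.one_le_rpow (by linarith) (by linarith)
  · linarith [Real.log_nonneg (by linarith : 1 ≤ 1 + s)]
  · exact le_rfl

theorem continuous_one_add_mul_rpow {R : ℝ} (p : ℝ) (hR : 0 ≤ R) :
    ContinuousOn (fun τ : ℝ => (1 + R * τ) ^ p) (Icc 0 1) := by
  refine ContinuousOn.rpow_const (by fun_prop) fun τ hτ => Or.inl ?_
  have := mul_nonneg hR hτ.1
  positivity

theorem integral_one_add_mul_rpow {R e : ℝ} (hR : 0 ≤ R) (he : e ≠ 0) :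
    ∫ τ in (0 : ℝ)..1, R * (1 + R * τ) ^ (e - 1) = ((1 + R) ^ e - 1) / e := by
  have hd : ∀ τ ∈ uIcc (0 : ℝ) 1,
      HasDerivAt (fun τ : ℝ => (1 + R * τ) ^ e / e) (R * (1 + R * τ) ^ (e - 1)) τ := by
    intro τ hτ
    rw [uIcc_of_le zero_le_one] at hτ
    have hpos : 0 < 1 + R * τ := by have := mul_nonneg hR hτ.1; positivity
    have h := ((((hasDerivAt_id τ).const_mul R).const_add 1).rpow_const (p := e)
      (Or.inl hpos.ne')).div_const e
    convert! h using 1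
    simp only [id]
    field_simp
  rw [intervalIntegral.integral_eq_sub_of_hasDerivAt hd]
  · simp; ring
  · refine ContinuousOn.intervalIntegrable ?_
    rw [uIcc_of_le zero_le_one]
    exact (continuous_one_add_mul_rpow _ hR).const_smul R

theorem integral_one_add_mul_inv {R : ℝ} (hR : 0 ≤ R) :
    ∫ τ in (0 : ℝ)..1, R * (1 + R * τ) ^ ((0 : ℝ) - 1) = Real.log (1 + R) := by
  have hd : ∀ τ ∈ uIcc (0 : ℝ) 1,
      HasDerivAt (fun τ : ℝ => Real.log (1 + R * τ)) (R * (1 + R * τ) ^ ((0 : ℝ) - 1)) τ := by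
    intro τ hτ
    rw [uIcc_of_le zero_le_one] at hτ
    have hpos : 0 < 1 + R * τ := by have := mul_nonneg hR hτ.1; positivity
    have h := (((hasDerivAt_id τ).const_mul R).const_add 1).log hpos.ne'
    convert! h using 1
    rw [zero_sub, Real.rpow_neg_one]
    simp [div_eq_mul_inv]
  rw [intervalIntegral.integral_eq_sub_of_hasDerivAt hd]
  · simp
  · refine ContinuousOn.intervalIntegrable ?_
    rw [uIcc_of_le zero_le_one]
    exact (continuous_one_add_mul_rpow _ hR).const_smul R

/-- With e = (d-1)/2 - α the integral is ((1+R)^e - 1)/e, or log(1+R) when e = 0; the sign of e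
gives the three regimes of `growth`. -/
theorem exists_integral_one_add_mul_rpow_le_growth (d : ℕ) (α : ℝ) {B : ℝ} (hB : 1 ≤ B) :
    ∃ C : ℝ, 0 < C ∧ ∀ R s : ℝ, 0 ≤ R → 0 ≤ s → 1 + R ≤ B * (1 + s) →
      ∫ τ in (0 : ℝ)..1, R * (1 + R * τ) ^ (((d : ℝ) - 1) / 2 - α - 1) ≤ C * growth d α s := by
  set e := ((d : ℝ) - 1) / 2 - α with he
  have hB0 : 0 < B := by linarith
  rcases lt_trichotomy α (((d : ℝ) - 1) / 2) with h | h | h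
  · have he0 : 0 < e := by linarith
    refine ⟨B ^ e / e, by positivity, fun R s hR hs hRs => ?_⟩
    rw [integral_one_add_mul_rpow hR he0.ne', growth, if_pos h,
      show ((d : ℝ) - 2 * α - 1) / 2 = e by rw [he]; ring, div_mul_eq_mul_div]
    refine div_le_div_of_nonneg_right ?_ he0.le
    have h1 : (1 + R) ^ e ≤ (B * (1 + s)) ^ e := Real.rpow_le_rpow (by linarith) hRs he0.le
    rw [Real.mul_rpow hB0.le (by linarith)] at h1
    linarith
  · have he0 : e = 0 := by linarith
    have hlog := Real.log_nonneg hB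
    refine ⟨Real.log B + 1, by positivity, fun R s hR hs hRs => ?_⟩
    rw [he0, integral_one_add_mul_inv hR, growth, if_neg (by linarith), if_pos h]
    have h1 := Real.log_le_log (by linarith) hRs
    rw [Real.log_mul hB0.ne' (by linarith)] at h1
    have h2 := Real.log_nonneg (by linarith : 1 ≤ 1 + s)
    nlinarith
  · have he0 : e < 0 := by linarith
    refine ⟨1 / (-e), by have := neg_pos.2 he0; positivity, fun R s hR hs hRs => ?_⟩
    rw [integral_one_add_mul_rpow hR he0.ne, growth, if_neg (by linarith), if_neg (by linarith),
      mul_one, ← neg_div_neg_eq]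
    refine div_le_div_of_nonneg_right ?_ (by linarith)
    have : 0 < (1 + R) ^ e := Real.rpow_pos_of_pos (by linarith) _
    linarith

/-- For R ≤ 1 the integrand is at most 1. For R ≥ 1, R^d τ^{d-1} ≤ R (1+Rτ)^{d-1} reduces to the
preceding integral, and 1 + R ≤ 2R^d ≤ (2/ω) s permits passing from R to s. -/
theorem exists_radial_integral_le_growth {d : ℕ} (hd : 1 ≤ d) {α : ℝ} (hα : -1 / 2 < α) {ω : ℝ}
    (hω : 0 < ω) :
    ∃ C : ℝ, 0 < C ∧ ∀ R s : ℝ, 0 ≤ R → 0 ≤ s → ω * R ^ d ≤ s →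
      R ^ d * ∫ τ in Ioo (0 : ℝ) 1, (1 + R * τ) ^ (-(α + d / 2 + 1 / 2)) * τ ^ (d - 1) ≤
        C * min 1 (R ^ d) * growth d α s := by
  have hd' : (1 : ℝ) ≤ d := by exact_mod_cast hd
  obtain ⟨C, hC, h⟩ := exists_integral_one_add_mul_rpow_le_growth d α (B := 2 / ω + 1)
    (by have : 0 < 2 / ω := by positivity
        linarith)
  refine ⟨max 1 C, by positivity, fun R s hR hs hRs => ?_⟩
  have hg := one_le_growth d α hs
  have hcont : ContinuousOn (fun τ : ℝ => (1 + R * τ) ^ (-(α + d / 2 + 1 / 2)) * τ ^ (d - 1))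
      (Icc 0 1) := (continuous_one_add_mul_rpow _ hR).mul (by fun_prop)
  have hint : IntegrableOn (fun τ : ℝ => (1 + R * τ) ^ (-(α + d / 2 + 1 / 2)) * τ ^ (d - 1))
      (Ioo 0 1) := (hcont.integrableOn_Icc).mono_set Ioo_subset_Icc_self
  have hone : ∀ τ ∈ Ioo (0 : ℝ) 1, 1 ≤ 1 + R * τ := fun τ hτ => by
    have := mul_nonneg hR hτ.1.le
    linarith
  rcases le_total R 1 with hR1 | hR1
  · have h1 : ∫ τ in Ioo (0 : ℝ) 1, (1 + R * τ) ^ (-(α + d / 2 + 1 / 2)) * τ ^ (d - 1) ≤ 1 := by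
      calc _ ≤ ∫ τ in Ioo (0 : ℝ) 1, (1 : ℝ) := by
            refine setIntegral_mono_on hint (integrableOn_const (by simp)) measurableSet_Ioo
              fun τ hτ => ?_
            refine mul_le_one₀ (Real.rpow_le_one_of_one_le_of_nonpos (hone τ hτ) (by linarith))
              (pow_nonneg hτ.1.le _) (pow_le_one₀ hτ.1.le hτ.2.le)
        _ = 1 := by simp
    have h2 : R ^ d ≤ 1 := pow_le_one₀ hR hR1
    rw [min_eq_right h2]
    have h3 : 0 ≤ R ^ d := by positivity
    calc _ ≤ R ^ d * 1 := by gcongr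
      _ ≤ (max 1 C * R ^ d) * 1 := by
          rw [mul_one, mul_one]; exact le_mul_of_one_le_left h3 (le_max_left _ _)
      _ ≤ _ := by gcongr
  · have hpow : R ≤ R ^ d := le_self_pow₀ hR1 (by omega)
    have h1 : 1 + R ≤ (2 / ω + 1) * (1 + s) := by
      have h2 : 2 * R ≤ 2 / ω * s := by
        rw [div_mul_eq_mul_div, le_div_iff₀ hω]
        nlinarith
      have h3 : 0 < 2 / ω := by positivity
      nlinarith
    rw [min_eq_left (one_le_pow₀ hR1), mul_one]
    refine le_trans ?_ ((h R s hR hs h1).trans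
      (mul_le_mul_of_nonneg_right (le_max_right _ _) (by linarith)))
    rw [intervalIntegral.integral_of_le zero_le_one, integral_Ioc_eq_integral_Ioo,
      ← integral_const_mul]
    refine setIntegral_mono_on (hint.const_mul _) ?_ measurableSet_Ioo fun τ hτ => ?_
    · exact (((continuous_one_add_mul_rpow _ hR).const_smul R).integrableOn_Icc).mono_set
        Ioo_subset_Icc_self
    · have h4 := hone τ hτ
      have h5 : 0 < 1 + R * τ := by linarith
      obtain ⟨n, rfl⟩ : ∃ n, d = n + 1 := ⟨d - 1, by omega⟩
      rw [show (((n + 1 : ℕ) : ℝ) - 1) / 2 - α - 1 =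
        -(α + (n + 1 : ℕ) / 2 + 1 / 2) + (n : ℕ) by push_cast; ring, Real.rpow_add h5,
        Real.rpow_natCast, Nat.add_sub_cancel]
      have h6 : (R * τ) ^ n ≤ (1 + R * τ) ^ n :=
        pow_le_pow_left₀ (mul_nonneg hR hτ.1.le) (by linarith) n
      have h7 : 0 < (1 + R * τ) ^ (-(α + (n + 1 : ℕ) / 2 + 1 / 2)) := by positivity
      rw [mul_pow] at h6
      calc _ = R * ((1 + R * τ) ^ (-(α + (n + 1 : ℕ) / 2 + 1 / 2)) * (R ^ n * τ ^ n)) := by ring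
        _ ≤ _ := by gcongr

/-! ### Duality -/

theorem integral_fourier_mul_eq_integral_mul_fourier {d : ℕ} {f g : EuclideanSpace ℝ (Fin d) → ℂ}
    (hf : Integrable f) (hg : Integrable g) :
    ∫ ξ, 𝓕 f ξ * g ξ = ∫ t, f t * 𝓕 g t := by
  simpa using! VectorFourier.integral_fourierIntegral_smul_eq_flip
    (L := innerₗ (EuclideanSpace ℝ (Fin d))) Real.continuous_fourierChar continuous_inner hf hg

theorem integrable_fourier_mul {d : ℕ} {f g : EuclideanSpace ℝ (Fin d) → ℂ}
    (hf : Integrable f) (hg : Integrable g) : Integrable fun ξ => 𝓕 f ξ * g ξ := by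
  refine Integrable.bdd_mul (c := ∫ v, ‖f v‖) hg ?_ (Filter.Eventually.of_forall fun ξ => ?_)
  · exact (VectorFourier.fourierIntegral_continuous (L := innerₗ (EuclideanSpace ℝ (Fin d)))
      Real.continuous_fourierChar continuous_inner hf).aestronglyMeasurable
  · exact VectorFourier.norm_fourierIntegral_le_integral_norm _ _ _ _ _

/-! ### Superlevel sets and rearrangements -/

/-- The radius of the symmetric rearrangement of a set. -/
noncomputable def symmRearrRadius {d : ℕ} (E : Set (EuclideanSpace ℝ (Fin d))) : ℝ :=
  (volume.real E / volume.real (Metric.ball (0 : EuclideanSpace ℝ (Fin d)) 1)) ^ (1 / (d : ℝ))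

theorem volume_real_unit_ball_pos (d : ℕ) :
    0 < volume.real (Metric.ball (0 : EuclideanSpace ℝ (Fin d)) 1) :=
  ENNReal.toReal_pos (Metric.measure_ball_pos volume _ one_pos).ne' measure_ball_lt_top.ne

theorem symmRearrRadius_nonneg {d : ℕ} (E : Set (EuclideanSpace ℝ (Fin d))) :
    0 ≤ symmRearrRadius E := by
  unfold symmRearrRadius
  positivity

theorem unit_ball_mul_symmRearrRadius_pow {d : ℕ} (hd : 1 ≤ d)
    (E : Set (EuclideanSpace ℝ (Fin d))) :
    volume.real (Metric.ball (0 : EuclideanSpace ℝ (Fin d)) 1) * symmRearrRadius E ^ d =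
      volume.real E := by
  have hω := volume_real_unit_ball_pos d
  rw [symmRearrRadius, one_div, Real.rpow_inv_natCast_pow (by positivity) (by omega)]
  field_simp

theorem volume_real_ball_symmRearrRadius {d : ℕ} (hd : 1 ≤ d)
    (E : Set (EuclideanSpace ℝ (Fin d))) (x : EuclideanSpace ℝ (Fin d)) :
    volume.real (Metric.ball x (symmRearrRadius E)) = volume.real E := by
  have hr := symmRearrRadius_nonneg E
  have : Nonempty (Fin d) := ⟨⟨0, hd⟩⟩
  rw [← unit_ball_mul_symmRearrRadius_pow hd E, Measure.real, Measure.addHaar_ball _ _ hr,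
    ENNReal.toReal_mul, ENNReal.toReal_ofReal (by positivity), finrank_euclideanSpace,
    Fintype.card_fin, mul_comm]
  rfl

theorem symmRearrSet_eq_ball {d : ℕ} (E : Set (EuclideanSpace ℝ (Fin d))) :
    symmRearrSet E = Metric.ball 0 (symmRearrRadius E) := rfl

theorem setLIntegral_ball_eq {d : ℕ} (κ : ℝ → ℝ≥0∞) (x : EuclideanSpace ℝ (Fin d)) (r : ℝ) :
    ∫⁻ t in Metric.ball x r, κ ‖t - x‖ = ∫⁻ t in Metric.ball (0 : EuclideanSpace ℝ (Fin d)) r,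
      κ ‖t‖ := by
  rw [← lintegral_indicator Metric.isOpen_ball.measurableSet,
    ← lintegral_indicator Metric.isOpen_ball.measurableSet,
    
    ← lintegral_sub_right_eq_self ((Metric.ball 0 r).indicator fun t => κ ‖t‖) x]
  refine lintegral_congr fun t => ?_
  simp [indicator, dist_eq_norm]

/-- The integral of a radially decreasing function over a set is controlled by its integral over
the rearranged set. -/
theorem setLIntegral_le_two_mul_setLIntegral_ball {d : ℕ} (hd : 1 ≤ d) {κ : ℝ → ℝ≥0∞}
    (hκ : AntitoneOn κ (Ici 0)) (hm : Measurable κ) {E : Set (EuclideanSpace ℝ (Fin d))}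
    (hE : volume E ≠ ∞) (x : EuclideanSpace ℝ (Fin d)) :
    ∫⁻ t in E, κ ‖t - x‖ ≤
      2 * ∫⁻ t in Metric.ball (0 : EuclideanSpace ℝ (Fin d)) (symmRearrRadius E), κ ‖t‖ := by
  set r := symmRearrRadius E with hr
  have hr0 : 0 ≤ r := symmRearrRadius_nonneg E
  have hvol : volume (Metric.ball x r) = volume E := by
    rw [← ENNReal.toReal_eq_toReal_iff' measure_ball_lt_top.ne hE]
    exact volume_real_ball_symmRearrRadius hd E x
  have hB : MeasurableSet (Metric.ball x r) := Metric.isOpen_ball.measurableSet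
  -- Inside the ball, E is enlarged to the ball. Outside, κ is at most κ(r), and κ(r)|E| =
  -- κ(r)|ball| is again at most the integral over the ball. Hence the factor 2.
  rw [← lintegral_add_compl _ hB, two_mul, ← setLIntegral_ball_eq κ x r]
  refine add_le_add (lintegral_mono' (Measure.restrict_mono_measure Measure.restrict_le_self _)
    le_rfl) ?_
  calc ∫⁻ t in (Metric.ball x r)ᶜ, κ ‖t - x‖ ∂(volume.restrict E)
      ≤ ∫⁻ t in (Metric.ball x r)ᶜ, κ r ∂(volume.restrict E) := by
        refine setLIntegral_mono measurable_const fun t ht => hκ hr0 (norm_nonneg _) ?_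
        simpa [dist_eq_norm] using ht
    _ ≤ κ r * volume E := by
        rw [setLIntegral_const]
        exact mul_le_mul' le_rfl
          ((measure_mono (subset_univ _)).trans_eq (Measure.restrict_apply_univ _))
    _ = ∫⁻ t in Metric.ball x r, κ r := by rw [setLIntegral_const, hvol]
    _ ≤ _ := by
        refine setLIntegral_mono (by fun_prop) fun t ht => hκ (norm_nonneg _) hr0 ?_
        exact (by simpa [dist_eq_norm] using ht : ‖t - x‖ < r).le

section Superlevel

variable {d : ℕ} {φ : EuclideanSpace ℝ (Fin d) → ℂ}

theorem volume_superlevel_ne_top (hφ : Integrable φ) {l : ℝ} (hl : 0 < l) :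
    volume {y | l < ‖φ y‖} ≠ ∞ :=
  (hφ.norm.measure_gt_lt_top hl).ne

theorem measurable_volume_superlevel :
    Measurable fun l : ℝ => volume {y : EuclideanSpace ℝ (Fin d) | l < ‖φ y‖} :=
  Antitone.measurable fun _ _ h => measure_mono fun _ hy => lt_of_le_of_lt h hy

theorem measurable_symmRearrRadius_superlevel :
    Measurable fun l : ℝ => symmRearrRadius {y : EuclideanSpace ℝ (Fin d) | l < ‖φ y‖} :=
  ((measurable_volume_superlevel.ennreal_toReal).div_const _).pow_const _

/-- The layer cake formula for the measure with density g. -/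
theorem lintegral_enorm_mul_eq (hφ : Integrable φ) {g : EuclideanSpace ℝ (Fin d) → ℝ≥0∞}
    (hg : Measurable g) :
    ∫⁻ t, ‖φ t‖ₑ * g t = ∫⁻ l in Ioi (0 : ℝ), ∫⁻ t in {y | l < ‖φ y‖}, g t := by
  have h := lintegral_eq_lintegral_meas_lt (volume.withDensity g) (f := fun t => ‖φ t‖)
    (Filter.Eventually.of_forall fun _ => norm_nonneg _)
    (hφ.1.norm.aemeasurable.mono' (withDensity_absolutelyContinuous _ _))
  simp only [withDensity_apply', ofReal_norm] at h
  rw [← h, lintegral_withDensity_eq_lintegral_mul₀ hg.aemeasurable hφ.1.enorm]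
  exact lintegral_congr fun t => mul_comm _ _

theorem integrableOn_volume_superlevel (hφ : Integrable φ) :
    IntegrableOn (fun l : ℝ => volume.real {y : EuclideanSpace ℝ (Fin d) | l < ‖φ y‖})
      (Ioi 0) := by
  refine ⟨measurable_volume_superlevel.ennreal_toReal.aestronglyMeasurable, ?_⟩
  have h := lintegral_enorm_mul_eq hφ (g := fun _ => 1) measurable_const
  simp only [mul_one, setLIntegral_one] at h
  have h2 : ∫⁻ t, ‖φ t‖ₑ < ∞ := hφ.2
  refine lt_of_le_of_lt (lintegral_mono fun l => ?_) (h ▸ h2)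
  exact (Real.enorm_of_nonneg measureReal_nonneg).trans_le ENNReal.ofReal_toReal_le

/-- For fixed l the ball has the volume of {|φ| > l}, which is integrable in l. This gives both
integrability of the rearrangement and Fubini against bounded kernels. -/
theorem integrable_indicator_prod (hd : 1 ≤ d) (hφ : Integrable φ) :
    Integrable (fun p : ℝ × EuclideanSpace ℝ (Fin d) =>
      (symmRearrSet {y | p.1 < ‖φ y‖}).indicator (1 : EuclideanSpace ℝ (Fin d) → ℝ) p.2)
      ((volume.restrict (Ioi 0)).prod volume) := by
  have hms : MeasurableSet {p : ℝ × EuclideanSpace ℝ (Fin d) |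
      ‖p.2‖ < symmRearrRadius {y | p.1 < ‖φ y‖}} :=
    measurableSet_lt (by fun_prop) (measurable_symmRearrRadius_superlevel.comp measurable_fst)
  have hmeas : Measurable (fun p : ℝ × EuclideanSpace ℝ (Fin d) =>
      (symmRearrSet {y | p.1 < ‖φ y‖}).indicator (1 : EuclideanSpace ℝ (Fin d) → ℝ) p.2) := by
    convert! (measurable_const (a := (1 : ℝ))).indicator hms using 1
    funext p
    simp [indicator, symmRearrSet, symmRearrRadius]
  rw [integrable_prod_iff hmeas.aestronglyMeasurable]
  constructor
  · refine Filter.Eventually.of_forall fun l => ?_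
    have hball : IntegrableOn (1 : EuclideanSpace ℝ (Fin d) → ℝ)
        (Metric.ball 0 (symmRearrRadius {y | l < ‖φ y‖})) :=
      integrableOn_const (C := (1 : ℝ)) measure_ball_lt_top.ne
    exact hball.integrable_indicator Metric.isOpen_ball.measurableSet
  · refine (integrableOn_volume_superlevel hφ).congr (Filter.Eventually.of_forall fun l => ?_)
    simp only [norm_indicator_eq_indicator_norm, Pi.one_apply, norm_one]
    rw [show (fun _ : EuclideanSpace ℝ (Fin d) => (1 : ℝ)) = 1 from rfl,
      symmRearrSet_eq_ball, integral_indicator_one Metric.isOpen_ball.measurableSet]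
    exact (volume_real_ball_symmRearrRadius hd _ 0).symm

theorem symmRearr_eq_integral (φ : EuclideanSpace ℝ (Fin d) → ℂ) (t : EuclideanSpace ℝ (Fin d)) :
    symmRearr φ t = ∫ l in Ioi (0 : ℝ),
      (symmRearrSet {y | l < ‖φ y‖}).indicator (1 : EuclideanSpace ℝ (Fin d) → ℝ) t := by
  rw [integral_eq_lintegral_of_nonneg_ae, symmRearr]
  · congr 1
    refine lintegral_congr fun l => ?_
    by_cases h : t ∈ symmRearrSet {y | l < ‖φ y‖} <;> simp [h]
  · exact Filter.Eventually.of_forall fun l => indicator_nonneg (fun _ _ => zero_le_one) _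
  · have hms : MeasurableSet {l : ℝ | ‖t‖ < symmRearrRadius {y | l < ‖φ y‖}} :=
      measurableSet_lt measurable_const measurable_symmRearrRadius_superlevel
    refine Measurable.aestronglyMeasurable ?_
    convert! (measurable_const (a := (1 : ℝ))).indicator hms using 1
    funext p
    simp [indicator, symmRearrSet, symmRearrRadius]

theorem integrable_symmRearr (hd : 1 ≤ d) (hφ : Integrable φ) : Integrable (symmRearr φ) := by
  rw [show symmRearr φ = _ from funext (symmRearr_eq_integral φ)]
  exact (integrable_indicator_prod hd hφ).integral_prod_right

theorem integral_symmRearr_mul (hd : 1 ≤ d) (hφ : Integrable φ)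
    {K : EuclideanSpace ℝ (Fin d) → ℝ} (hK : Measurable K) {C : ℝ} (hC : ∀ t, |K t| ≤ C) :
    IntegrableOn (fun l : ℝ => ∫ t in Metric.ball (0 : EuclideanSpace ℝ (Fin d))
      (symmRearrRadius {y | l < ‖φ y‖}), K t) (Ioi 0) ∧
    ∫ t, symmRearr φ t * K t = ∫ l in Ioi (0 : ℝ),
      ∫ t in Metric.ball (0 : EuclideanSpace ℝ (Fin d)) (symmRearrRadius {y | l < ‖φ y‖}), K t := by
  have hint : Integrable (fun p : ℝ × EuclideanSpace ℝ (Fin d) =>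
      (symmRearrSet {y | p.1 < ‖φ y‖}).indicator (1 : EuclideanSpace ℝ (Fin d) → ℝ) p.2 * K p.2)
      ((volume.restrict (Ioi 0)).prod volume) :=
    (integrable_indicator_prod hd hφ).mul_bdd (c := C)
      (hK.comp measurable_snd).aestronglyMeasurable (Filter.Eventually.of_forall fun p => hC p.2)
  have h1 : ∀ l : ℝ, ∫ t, (symmRearrSet {y | l < ‖φ y‖}).indicator
      (1 : EuclideanSpace ℝ (Fin d) → ℝ) t * K t =
      ∫ t in Metric.ball (0 : EuclideanSpace ℝ (Fin d)) (symmRearrRadius {y | l < ‖φ y‖}), K t := by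
    intro l
    rw [← integral_indicator Metric.isOpen_ball.measurableSet]
    refine integral_congr_ae (Filter.Eventually.of_forall fun t => ?_)
    simp only [indicator, symmRearrSet, symmRearrRadius, Pi.one_apply]
    split_ifs <;> simp
  refine ⟨hint.integral_prod_left.congr (Filter.Eventually.of_forall h1), ?_⟩
  simp only [symmRearr_eq_integral, ← integral_mul_const]
  rw [← integral_integral_swap hint]
  simp only [h1]

end Superlevel

theorem integrableOn_min_one_pow {d : ℕ} (hd : 1 ≤ d) {φ : EuclideanSpace ℝ (Fin d) → ℂ}
    (hφ : Integrable φ) {Ω : ℝ} (hΩ : 0 < Ω) :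
    IntegrableOn (fun l : ℝ => min 1 ((Ω * symmRearrRadius {y | l < ‖φ y‖}) ^ d)) (Ioi 0) := by
  have hω := volume_real_unit_ball_pos d
  set ω := volume.real (Metric.ball (0 : EuclideanSpace ℝ (Fin d)) 1) with hωdef
  refine ((integrableOn_volume_superlevel hφ).const_mul (Ω ^ d / ω)).mono' ?_
    (Filter.Eventually.of_forall fun l => ?_)
  · exact (measurable_const.min
      ((measurable_symmRearrRadius_superlevel.const_mul Ω).pow_const d)).aestronglyMeasurable
  · have hr := symmRearrRadius_nonneg {y | l < ‖φ y‖}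
    rw [Real.norm_of_nonneg (by positivity), ← unit_ball_mul_symmRearrRadius_pow hd, ← hωdef,
      mul_pow]
    refine (min_le_right _ _).trans_eq ?_
    field_simp

/-! ### The lower bound for the rearrangement -/

/-- Polar coordinates give the radial bound with p = d/2, for which 2p - 1 = d - 1. -/
theorem exists_le_setIntegral_ball_besselClifford {d : ℕ} (hd : 1 ≤ d) {ν : ℝ}
    (hν : (d : ℝ) - 1 ≤ ν) :
    ∃ c : ℝ, 0 < c ∧ ∀ Ω r : ℝ, 0 < Ω → 0 ≤ r → c * min 1 ((Ω * r) ^ d) ≤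
      ∫ t in Metric.ball (0 : EuclideanSpace ℝ (Fin d)) r,
        Ω ^ d * besselClifford ν ((2 * Real.pi * Ω * ‖t‖) ^ 2 / 4) := by
  have hd' : (1 : ℝ) ≤ d := by exact_mod_cast hd
  obtain ⟨c, hc, h⟩ := exists_le_integral_besselClifford (p := d / 2) (ν := ν) (by linarith)
    (by linarith)
  have hω := volume_real_unit_ball_pos d
  have hpi := Real.pi_pos
  have hpi2 : 1 ≤ 2 * Real.pi := by linarith [Real.pi_gt_three]
  refine ⟨d * volume.real (Metric.ball (0 : EuclideanSpace ℝ (Fin d)) 1) *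
    (c * ((2 * Real.pi) ^ d)⁻¹), by positivity, fun Ω r hΩ hr => ?_⟩
  rcases hr.eq_or_lt with rfl | hr
  · have : d ≠ 0 := by omega
    simp [this]
  rw [setIntegral_ball_fun_norm hd
    (fun ρ => Ω ^ d * besselClifford ν ((2 * Real.pi * Ω * ρ) ^ 2 / 4)) hr, mul_assoc]
  refine mul_le_mul_of_nonneg_left ?_ (by positivity)
  have h1 := h (2 * Real.pi * Ω * r) (by positivity)
  have h2 : ∫ τ in Ioo (0 : ℝ) 1, Ω ^ d * besselClifford ν
      ((2 * Real.pi * Ω * (r * τ)) ^ 2 / 4) * τ ^ (d - 1) = Ω ^ d * ∫ τ in Ioo (0 : ℝ) 1,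
        besselClifford ν ((2 * Real.pi * Ω * r) ^ 2 / 4 * τ ^ 2) * τ ^ (2 * ((d : ℝ) / 2) - 1) := by
    rw [← integral_const_mul]
    refine setIntegral_congr_fun measurableSet_Ioo fun τ hτ => ?_
    rw [show 2 * ((d : ℝ) / 2) - 1 = ((d - 1 : ℕ) : ℝ) by rw [Nat.cast_sub hd]; push_cast; ring,
      Real.rpow_natCast, mul_assoc]
    ring_nf
  rw [h2, ← mul_assoc, ← mul_pow, mul_comm r Ω]
  set R := Ω * r with hR
  have hRpos : 0 < R := by positivity
  rw [show 2 * Real.pi * Ω * r = 2 * Real.pi * R by rw [hR]; ring,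
    show 2 * ((d : ℝ) / 2) = d by ring, Real.rpow_neg (by positivity), Real.rpow_natCast] at h1
  rw [show 2 * Real.pi * Ω * r = 2 * Real.pi * R by rw [hR]; ring,
    show 2 * ((d : ℝ) / 2) = d by ring]
  refine le_trans ?_ (mul_le_mul_of_nonneg_left h1 (by positivity))
  have h3 : ((2 * Real.pi) ^ d)⁻¹ ≤ 1 := inv_le_one_of_one_le₀ (one_le_pow₀ hpi2)
  have h4 : 0 < R ^ d := by positivity
  -- The factor (2π)^{-d} absorbs the 2π in the kernel's frequency.
  have h5 : ((2 * Real.pi) ^ d)⁻¹ * min 1 (R ^ d) ≤ R ^ d * min 1 ((2 * Real.pi * R) ^ d)⁻¹ := by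
    rw [mul_min_of_nonneg _ _ h4.le, mul_pow (2 * Real.pi) R, mul_inv]
    refine le_min ?_ ?_
    · refine (mul_le_of_le_one_left (le_min zero_le_one h4.le) h3).trans ?_
      rw [mul_one]
      exact min_le_right _ _
    · rw [mul_left_comm, mul_inv_cancel₀ h4.ne']
      exact mul_le_mul_of_nonneg_left (min_le_left _ _) (by positivity)
  calc _ = c * (((2 * Real.pi) ^ d)⁻¹ * min 1 (R ^ d)) := by ring
    _ ≤ c * (R ^ d * min 1 ((2 * Real.pi * R) ^ d)⁻¹) := by gcongr
    _ = _ := by ring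

theorem exists_le_integral_rearrIntegrand {d : ℕ} (hd : 1 ≤ d) {β : ℝ}
    (hβ : (d : ℝ) / 2 - 1 ≤ β) :
    ∃ c : ℝ, 0 < c ∧ ∀ Ω : ℝ, 0 < Ω → ∀ φ : EuclideanSpace ℝ (Fin d) → ℂ, Integrable φ →
      Integrable (rearrIntegrand β Ω φ) ∧ (∫ ξ, rearrIntegrand β Ω φ ξ).im = 0 ∧
      c * ∫ l in Ioi (0 : ℝ), min 1 ((Ω * symmRearrRadius {y | l < ‖φ y‖}) ^ d) ≤
        (∫ ξ, rearrIntegrand β Ω φ ξ).re := by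
  have hd' : (1 : ℝ) ≤ d := by exact_mod_cast hd
  have hβ' : -1 < β := by linarith
  obtain ⟨A, hA, hfour⟩ := exists_fourier_bochnerRiesz hd hβ'
  obtain ⟨c, hc, hlow⟩ := exists_le_setIntegral_ball_besselClifford hd (ν := β + d / 2)
    (by linarith)
  obtain ⟨C, hC, hdecay⟩ := exists_abs_besselClifford_le (ν := β + d / 2) (by linarith)
  refine ⟨A * c, by positivity, fun Ω hΩ φ hφ => ?_⟩
  have hf : Integrable fun t => ((symmRearr φ t : ℝ) : ℂ) := (integrable_symmRearr hd hφ).ofReal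
  have hg : Integrable fun ξ : EuclideanSpace ℝ (Fin d) => (bochnerRiesz β Ω ξ : ℂ) :=
    (integrable_bochnerRiesz hd hβ' hΩ).ofReal
  have hpi := Real.pi_pos
  set K : EuclideanSpace ℝ (Fin d) → ℝ := fun t =>
    A * (Ω ^ d * besselClifford (β + d / 2) ((2 * Real.pi * Ω * ‖t‖) ^ 2 / 4)) with hKdef
  have hK : Measurable K := by
    refine Continuous.measurable (continuous_const.mul (continuous_const.mul ?_))
    exact (continuous_besselClifford (by linarith)).comp (by fun_prop)
  have hKb : ∀ t, |K t| ≤ A * (Ω ^ d * C) := by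
    intro t
    rw [hKdef]
    simp only
    rw [abs_mul, abs_mul, abs_of_pos hA, abs_of_pos (pow_pos hΩ d)]
    gcongr
    refine (hdecay _ (by positivity)).trans (mul_le_of_le_one_right hC.le ?_)
    refine Real.rpow_le_one_of_one_le_of_nonpos ?_ (by linarith)
    have : 0 ≤ 2 * Real.pi * Ω * ‖t‖ := by positivity
    linarith
  obtain ⟨hint, heq⟩ := integral_symmRearr_mul hd hφ hK hKb
  have hval : ∫ ξ, rearrIntegrand β Ω φ ξ = ((∫ t, symmRearr φ t * K t : ℝ) : ℂ) := by
    rw [← integral_complex_ofReal]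
    have := integral_fourier_mul_eq_integral_mul_fourier hf hg
    simp only [rearrIntegrand, mul_comm (bochnerRiesz β Ω _ : ℂ)]
    refine this.trans (integral_congr_ae (Filter.Eventually.of_forall fun t => ?_))
    beta_reduce
    rw [hfour Ω hΩ t, hKdef]
    push_cast
    ring
  refine ⟨?_, by rw [hval, Complex.ofReal_im], ?_⟩
  · simpa only [rearrIntegrand, mul_comm] using! integrable_fourier_mul hf hg
  · rw [hval, Complex.ofReal_re, heq, ← integral_const_mul]
    refine setIntegral_mono_on ((integrableOn_min_one_pow hd hφ hΩ).const_mul _) hint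
      measurableSet_Ioi fun l hl => ?_
    rw [hKdef]
    simp only
    rw [integral_const_mul, mul_assoc]
    exact mul_le_mul_of_nonneg_left (hlow Ω _ hΩ (symmRearrRadius_nonneg _)) hA.le

/-! ### The upper bound for the Bochner–Riesz mean -/

/-- Translation by a becomes a phase and modulation by x a translation, so estimates are uniform in
both. -/
theorem norm_fourier_translate_modulate {d : ℕ} (m : EuclideanSpace ℝ (Fin d) → ℂ)
    (a x t : EuclideanSpace ℝ (Fin d)) :
    ‖𝓕 (fun ξ : EuclideanSpace ℝ (Fin d) => m (ξ - a) *
      Complex.exp (2 * (Real.pi : ℂ) * Complex.I * ((inner ℝ x ξ : ℝ) : ℂ))) t‖ =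
      ‖𝓕 m (t - x)‖ := by
  have h : ∀ ξ : EuclideanSpace ℝ (Fin d), Real.fourierChar (-inner ℝ ξ t) • (m (ξ - a) *
      Complex.exp (2 * (Real.pi : ℂ) * Complex.I * ((inner ℝ x ξ : ℝ) : ℂ))) =
      (Real.fourierChar (-inner ℝ a (t - x)) : ℂ) *
        (Real.fourierChar (-inner ℝ (ξ - a) (t - x)) • m (ξ - a)) := by
    intro ξ
    simp only [Circle.smul_def, Real.fourierChar_apply, smul_eq_mul]
    rw [mul_comm (m (ξ - a)), ← mul_assoc, ← mul_assoc, ← Complex.exp_add, ← Complex.exp_add]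
    congr 2
    rw [inner_sub_left, inner_sub_right, inner_sub_right, real_inner_comm x ξ]
    push_cast
    ring
  rw [Real.fourier_eq, Real.fourier_eq]
  simp only [h]
  rw [integral_const_mul, integral_sub_right_eq_self
    (fun ξ => Real.fourierChar (-inner ℝ ξ (t - x)) • m ξ) a, norm_mul, Circle.norm_coe, one_mul]

theorem exists_norm_fourier_bochnerRiesz_le {d : ℕ} (hd : 1 ≤ d) {α : ℝ} (hα : -1 / 2 < α) :
    ∃ C : ℝ, 0 < C ∧ ∀ Ω : ℝ, 0 < Ω → ∀ t : EuclideanSpace ℝ (Fin d),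
      ‖𝓕 (fun ξ : EuclideanSpace ℝ (Fin d) => (bochnerRiesz α Ω ξ : ℂ)) t‖ ≤
        Ω ^ d * C * (1 + Ω * ‖t‖) ^ (-(α + d / 2 + 1 / 2)) := by
  have hd' : (1 : ℝ) ≤ d := by exact_mod_cast hd
  obtain ⟨A, hA, hfour⟩ := exists_fourier_bochnerRiesz hd (α := α) (by linarith)
  obtain ⟨C, hC, hdecay⟩ := exists_abs_besselClifford_le (ν := α + d / 2) (by linarith)
  refine ⟨A * C, by positivity, fun Ω hΩ t => ?_⟩
  have hpi := Real.pi_gt_three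
  rw [hfour Ω hΩ t, Complex.norm_real, Real.norm_eq_abs, abs_mul, abs_mul, abs_of_pos hA,
    abs_of_pos (pow_pos hΩ d), mul_assoc (Ω ^ d), mul_assoc A]
  gcongr
  refine (hdecay (2 * Real.pi * Ω * ‖t‖) (by positivity)).trans (mul_le_mul_of_nonneg_left ?_ hC.le)
  refine Real.rpow_le_rpow_of_nonpos (by positivity) ?_ (by linarith)
  have : 0 ≤ Ω * ‖t‖ := by positivity
  nlinarith

theorem exists_setLIntegral_ball_le_growth {d : ℕ} (hd : 1 ≤ d) {α : ℝ} (hα : -1 / 2 < α) {A : ℝ}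
    (hA : 0 < A) :
    ∃ C : ℝ, 0 < C ∧ ∀ Ω r S : ℝ, 0 < Ω → 0 ≤ r →
      volume.real (Metric.ball (0 : EuclideanSpace ℝ (Fin d)) 1) * r ^ d ≤ S →
      ∫⁻ t in Metric.ball (0 : EuclideanSpace ℝ (Fin d)) r,
        ENNReal.ofReal (Ω ^ d * A * (1 + Ω * ‖t‖) ^ (-(α + d / 2 + 1 / 2))) ≤
        ENNReal.ofReal (C * growth d α (Ω ^ d * S) * min 1 ((Ω * r) ^ d)) := by
  have hω := volume_real_unit_ball_pos d
  set ω := volume.real (Metric.ball (0 : EuclideanSpace ℝ (Fin d)) 1) with hωdef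
  obtain ⟨C, hC, h⟩ := exists_radial_integral_le_growth hd hα hω
  refine ⟨d * ω * (A * C), by positivity, fun Ω r S hΩ hr hS => ?_⟩
  rcases hr.eq_or_lt with rfl | hr
  · simp
  have hcont : Continuous fun t : EuclideanSpace ℝ (Fin d) =>
      Ω ^ d * A * (1 + Ω * ‖t‖) ^ (-(α + d / 2 + 1 / 2)) := by
    refine continuous_const.mul (Continuous.rpow_const (by fun_prop) fun t => Or.inl ?_)
    positivity
  have hint : IntegrableOn (fun t : EuclideanSpace ℝ (Fin d) =>
      Ω ^ d * A * (1 + Ω * ‖t‖) ^ (-(α + d / 2 + 1 / 2))) (Metric.ball 0 r) :=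
    (hcont.continuousOn.integrableOn_compact (isCompact_closedBall 0 r)).mono_set
      Metric.ball_subset_closedBall
  rw [← ofReal_integral_eq_lintegral_ofReal hint
    (Filter.Eventually.of_forall fun t => by simp only [Pi.zero_apply]; positivity)]
  refine ENNReal.ofReal_le_ofReal ?_
  rw [setIntegral_ball_fun_norm hd
    (fun ρ => Ω ^ d * A * (1 + Ω * ρ) ^ (-(α + d / 2 + 1 / 2))) hr, ← hωdef]
  have h1 := h (Ω * r) (Ω ^ d * S) (by positivity)
    (by have := (by positivity : 0 ≤ ω * r ^ d).trans hS
        positivity)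
    (by rw [mul_pow, mul_left_comm]; gcongr)
  have h2 : r ^ d * ∫ τ in Ioo (0 : ℝ) 1, Ω ^ d * A * (1 + Ω * (r * τ)) ^ (-(α + d / 2 + 1 / 2)) *
      τ ^ (d - 1) = A * ((Ω * r) ^ d * ∫ τ in Ioo (0 : ℝ) 1,
        (1 + Ω * r * τ) ^ (-(α + d / 2 + 1 / 2)) * τ ^ (d - 1)) := by
    simp only [mul_assoc, integral_const_mul, mul_pow]
    ring
  rw [h2]
  calc _ ≤ d * ω * (A * (C * min 1 ((Ω * r) ^ d) * growth d α (Ω ^ d * S))) := by gcongr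
    _ = _ := by ring

theorem exists_norm_integral_meanIntegrand_le {d : ℕ} (hd : 1 ≤ d) {α : ℝ} (hα : -1 / 2 < α) :
    ∃ C : ℝ, 0 < C ∧ ∀ S Ω : ℝ, 0 < S → 0 < Ω →
      ∀ φ : EuclideanSpace ℝ (Fin d) → ℂ, Integrable φ →
        volume (Function.support φ) = ENNReal.ofReal S → ∀ a x : EuclideanSpace ℝ (Fin d),
        Integrable (meanIntegrand α Ω a x φ) ∧
        ‖∫ ξ, meanIntegrand α Ω a x φ ξ‖ ≤ C * growth d α (Ω ^ d * S) *
          ∫ l in Ioi (0 : ℝ), min 1 ((Ω * symmRearrRadius {y | l < ‖φ y‖}) ^ d) := by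
  have hd' : (1 : ℝ) ≤ d := by exact_mod_cast hd
  obtain ⟨A, hA, hfour⟩ := exists_norm_fourier_bochnerRiesz_le hd hα
  obtain ⟨C, hC, hball⟩ := exists_setLIntegral_ball_le_growth hd hα hA
  refine ⟨2 * C, by positivity, fun S Ω hS hΩ φ hφ hsupp a x => ?_⟩
  have hgr := one_le_growth d α (by positivity : 0 ≤ Ω ^ d * S)
  set m : EuclideanSpace ℝ (Fin d) → ℂ := fun ξ => (bochnerRiesz α Ω ξ : ℂ) with hm
  set g : EuclideanSpace ℝ (Fin d) → ℂ := fun ξ => m (ξ - a) *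
      Complex.exp (2 * (Real.pi : ℂ) * Complex.I * ((inner ℝ x ξ : ℝ) : ℂ)) with hgdef
  have hg : Integrable g := by
    refine Integrable.mul_bdd (c := 1)
      ((integrable_bochnerRiesz hd (by linarith) hΩ).ofReal.comp_sub_right a)
      (Continuous.aestronglyMeasurable (by fun_prop)) (Filter.Eventually.of_forall fun ξ => ?_)
    rw [show 2 * (Real.pi : ℂ) * Complex.I * ((inner ℝ x ξ : ℝ) : ℂ) =
      ((2 * Real.pi * inner ℝ x ξ : ℝ) : ℂ) * Complex.I by push_cast; ring,
      Complex.norm_exp_ofReal_mul_I]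
  have hmean : meanIntegrand α Ω a x φ = fun ξ => 𝓕 φ ξ * g ξ := by
    funext ξ
    simp only [meanIntegrand, hgdef, hm, mul_assoc]
  rw [hmean]
  refine ⟨integrable_fourier_mul hφ hg, ?_⟩
  rw [integral_fourier_mul_eq_integral_mul_fourier hφ hg]
  set κ : ℝ → ℝ≥0∞ := fun ρ =>
    ENNReal.ofReal (Ω ^ d * A * (1 + Ω * ρ) ^ (-(α + d / 2 + 1 / 2))) with hκdef
  have hκanti : AntitoneOn κ (Ici 0) := by
    intro u hu v hv huv
    have hu0 : 0 ≤ Ω * u := mul_nonneg hΩ.le hu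
    refine ENNReal.ofReal_le_ofReal (mul_le_mul_of_nonneg_left ?_ (by positivity))
    exact Real.rpow_le_rpow_of_nonpos (by linarith) (by gcongr) (by linarith)
  have hκm : Measurable κ := by fun_prop
  have hM := integrableOn_min_one_pow hd hφ hΩ
  have hnn : ∀ l : ℝ, 0 ≤ min 1 ((Ω * symmRearrRadius {y | l < ‖φ y‖}) ^ d) := fun l => by
    have := symmRearrRadius_nonneg {y | l < ‖φ y‖}
    positivity
  -- In extended nonnegative reals the layer cake and rearrangement steps need no integrability of
  -- the majorant.
  rw [← ENNReal.ofReal_le_ofReal_iff (mul_nonneg (by positivity) (integral_nonneg hnn)),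
    ofReal_norm]
  calc ‖∫ t, φ t * 𝓕 g t‖ₑ ≤ ∫⁻ t, ‖φ t * 𝓕 g t‖ₑ := enorm_integral_le_lintegral_enorm _
    _ ≤ ∫⁻ t, ‖φ t‖ₑ * κ ‖t - x‖ := by
        refine lintegral_mono fun t => ?_
        rw [enorm_mul]
        refine mul_le_mul' le_rfl ?_
        rw [← ofReal_norm, norm_fourier_translate_modulate]
        exact ENNReal.ofReal_le_ofReal (hfour Ω hΩ (t - x))
    _ = ∫⁻ l in Ioi (0 : ℝ), ∫⁻ t in {y | l < ‖φ y‖}, κ ‖t - x‖ :=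
        lintegral_enorm_mul_eq hφ (by fun_prop)
    _ ≤ ∫⁻ l in Ioi (0 : ℝ), ENNReal.ofReal (2 * C * growth d α (Ω ^ d * S) *
          min 1 ((Ω * symmRearrRadius {y | l < ‖φ y‖}) ^ d)) := by
        refine setLIntegral_mono' measurableSet_Ioi fun l hl => ?_
        have hl0 : 0 < l := hl
        refine (setLIntegral_le_two_mul_setLIntegral_ball hd hκanti hκm
          (volume_superlevel_ne_top hφ hl0) x).trans ?_
        rw [mul_assoc 2 C, mul_assoc 2, ENNReal.ofReal_mul two_pos.le, ENNReal.ofReal_ofNat]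
        refine mul_le_mul' le_rfl (hball Ω _ S hΩ (symmRearrRadius_nonneg _) ?_)
        rw [unit_ball_mul_symmRearrRadius_pow hd]
        -- Positive superlevel sets lie in the support, so their volume is at most S; this makes
        -- ψ(Ω^d S) uniform in the level.
        refine ENNReal.toReal_le_of_le_ofReal hS.le (hsupp ▸ measure_mono fun y hy => ?_)
        exact norm_pos_iff.1 (hl0.trans hy)
    _ = _ := by
        rw [← integral_const_mul, ofReal_integral_eq_lintegral_ofReal (hM.const_mul _)]
        exact Filter.Eventually.of_forall fun l => mul_nonneg (by positivity) (hnn l)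

end

theorem mainTheorem2 (d : ℕ) (hd : 1 ≤ d) (α β : ℝ) (hβ : (d : ℝ) / 2 - 1 ≤ β)
    (hα : -1 / 2 < α) :
    ∃ C : ℝ, 0 < C ∧
      ∀ S Ω : ℝ, 0 < S → 0 < Ω →
      ∀ φ : EuclideanSpace ℝ (Fin d) → ℂ, Integrable φ →
        volume (Function.support φ) = ENNReal.ofReal S →
      Integrable (symmRearr φ) ∧
      Integrable (rearrIntegrand β Ω φ) ∧
      (∫ ξ, rearrIntegrand β Ω φ ξ).im = 0 ∧
      ∀ a x : EuclideanSpace ℝ (Fin d),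
        Integrable (meanIntegrand α Ω a x φ) ∧
        (Ω ^ d)⁻¹ * ‖∫ ξ, meanIntegrand α Ω a x φ ξ‖ ≤
          C * growth d α (Ω ^ d * S) *
            ((Ω ^ d)⁻¹ * (∫ ξ, rearrIntegrand β Ω φ ξ).re) := by
  obtain ⟨c, hc, hlow⟩ := exists_le_integral_rearrIntegrand hd hβ
  obtain ⟨C, hC, hup⟩ := exists_norm_integral_meanIntegrand_le hd hα
  -- The quotient eliminates the common integral of min(1, (Ω r_l)^d).
  refine ⟨C / c, by positivity, fun S Ω hS hΩ φ hφ hsupp => ?_⟩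
  obtain ⟨hint, him, hre⟩ := hlow Ω hΩ φ hφ
  refine ⟨integrable_symmRearr hd hφ, hint, him, fun a x => ?_⟩
  obtain ⟨hmean, hle⟩ := hup S Ω hS hΩ φ hφ hsupp a x
  refine ⟨hmean, ?_⟩
  have hgr := one_le_growth d α (by positivity : 0 ≤ Ω ^ d * S)
  rw [mul_left_comm]
  refine mul_le_mul_of_nonneg_left (hle.trans ?_) (by positivity)
  rw [mul_comm] at hre
  rw [div_mul_eq_mul_div, div_mul_eq_mul_div, le_div_iff₀ hc, mul_assoc]
  exact mul_le_mul_of_nonneg_left hre (by positivity)
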